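/- Let $K$ be a field of characteristic $0$, let $x=q_1=t_1$, and write $'=\mathrm D=\partial/\partial x$. For $i\ge 1$ put $$\alpha_{2i-1}=(-1)^{i-1}\,3^2 5^2\cdots(2i-3)^2\,(2i-1),\qquad \mu_n=\prod_{j=1}^n(2n-2j+1)^j .$$ Define polynomials $\psi_j$ ($j\ge1$) in $x,q_3,q_5,\dots$ by $$\sum_{j\ge1}\psi_j z^{2j-1}=\sinh(xz)+\cosh(xz)\sum_{i\ge2}\frac{q_{2i-1}}{\alpha_{2i-1}}z^{2i-1},$$ and let the Adler–Moser polynomials be normalised by $$\theta_n(\mathbf q)=\mu_n\,\mathrm{Wr}(\psi_1,\dots,\psi_n)=\mu_n\det\bigl(\mathrm D^{i-1}\psi_j\bigr)_{1\le i,j\le n}\qquad(n\ge0).$$ **Theorem.** 1. These polynomials solve the Adler–Moser recursion with $q_{2n-1}$ as the integration constant entering at $\theta_n$: $\theta_0=1$, $\theta_1=x$, $$\theta_{n+1}'\theta_{n-1}-\theta_{n+1}\theta_{n-1}'=(2n+1)\theta_n^2\quad(n\ge1),$$ and for $n\ge2$ one has $\theta_n=\mathring\theta_n+q_{2n-1}\theta_{n-2}$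 with $\mathring\theta_n\in K[q_1,q_3,\dots,q_{2n-3}]$. 2. The relations $q_1=t_1=x$ and $$\sum_{i\ge2}\frac{q_{2i-1}}{\alpha_{2i-1}}z^{2i-1}=\tanh\Bigl(\sum_{i\ge2}t_{2i-1}z^{2i-1}\Bigr)$$ define a polynomial change of variables $\mathbf q=\mathbf q(\mathbf t)$: the substitution $q_{2i-1}\mapsto q_{2i-1}(\mathbf t)$ is a bijective $K$-algebra homomorphism $K[q_1,q_3,\dots]\to K[t_1,t_3,\dots]$. 3. It transforms the Adler–Moser polynomials into polynomial tau functions of the KdV hierarchy. That is, for every $n\ge0$ the polynomial $\tau_n(\mathbf t)=\theta_n(\mathbf q(\mathbf t))$ is nonzero, and with $u_n=2(\log\tau_n)''$ the operator $L_n=\mathrm D^2+u_n$ has a unique square root $L_n^{1/2}=\mathrm D+\sum_{k\le 0}p_k\mathrm D^{k}$ among the formal pseudo-differential operators whose coefficients are rational functions of $\mathbf t$, and $$\frac{\partial L_n}{\partial t_{2i-1}}=\Bigl[\bigl(L_n^{(2i-1)/2}\bigr)_+,\,L_n\Bigr]\qquad\text{for all } i\ge1,$$ where $X_+$ denotes the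 purely differential part of $X$. -/

import Mathlib

open scoped nonZeroDivisors Differential

/-! ### Extension of a derivation to the fraction field -/

namespace Derivation

variable {k R : Type*} (F : Type*) [CommRing k] [CommRing R] [IsDomain R] [Algebra k R]
  [Field F] [Algebra R F] [IsFractionRing R F]

/-- The quotient rule `(a / b)' = (a' b - a b') / b²` for a chosen representation `a / b` of `f`;
`fracFun_div` shows that the result does not depend on the representation. -/
noncomputable def fracFun (d : Derivation k R R) (f : F) : F :=
  let a : R := (IsLocalization.sec R⁰ f).1
  let b : R := (IsLocalization.sec R⁰ f).2
  algebraMap R F (d a * b - a * d b) / algebraMap R F b ^ 2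

theorem fracFun_div (d : Derivation k R R) (a b : R) (hb : b ≠ 0) :
    d.fracFun F (algebraMap R F a / algebraMap R F b) =
      algebraMap R F (d a * b - a * d b) /
        algebraMap R F b ^ 2 := by
  unfold fracFun
  set f : F := algebraMap R F a / algebraMap R F b
    with hf
  have hs := IsLocalization.sec_spec R⁰ f
  set p : R := (IsLocalization.sec R⁰ f).1
  set q : R := ((IsLocalization.sec R⁰ f).2 : R) with hqdef
  have hq : q ≠ 0 := nonZeroDivisors.coe_ne_zero _
  have inj : Function.Injective (algebraMap R F) :=
    IsFractionRing.injective R F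
  have hq' : algebraMap R F q ≠ 0 := by simpa using hq
  have hb' : algebraMap R F b ≠ 0 := by simpa using hb
  have h1 : a * q = p * b := by
    apply inj
    rw [map_mul, map_mul, ← hs, hf]
    field_simp
  have h2 : d a * q + a * d q = d p * b + p * d b := by
    have := congrArg d h1
    simp only [Derivation.leibniz, smul_eq_mul] at this
    linear_combination this
  have key : (d p * q - p * d q) * b ^ 2 = (d a * b - a * d b) * q ^ 2 := by
    linear_combination (-(b * q)) * h2 + (b * d q + q * d b) * h1
  change algebraMap R F (d p * q - p * d q) / algebraMap R F q ^ 2 = _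
  rw [div_eq_div_iff (pow_ne_zero _ hq') (pow_ne_zero _ hb'), ← map_pow, ← map_pow, ← map_mul,
    ← map_mul, key]

/-- The unique extension of a derivation of a domain to its field of fractions. -/
noncomputable def frac (d : Derivation k R R) :
    Derivation ℤ F F :=
  Derivation.mk'
    (AddMonoidHom.toIntLinearMap
      { toFun := d.fracFun F
        map_zero' := by
          have h := d.fracFun_div F 0 1 one_ne_zero
          simpa using h
        map_add' := by
          intro f g
          obtain ⟨a, b, hb, rfl⟩ := IsFractionRing.div_surjective (A := R) f
          obtain ⟨p, q, hq, rfl⟩ := IsFractionRing.div_surjective (A := R) g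
          have hb0 : b ≠ 0 := nonZeroDivisors.ne_zero hb
          have hq0 : q ≠ 0 := nonZeroDivisors.ne_zero hq
          have hq' : algebraMap R F q ≠ 0 := by simpa using hq0
          have hb' : algebraMap R F b ≠ 0 := by simpa using hb0
          rw [div_add_div _ _ hb' hq', ← map_mul, ← map_mul, ← map_mul, ← map_add,
            fracFun_div F _ _ _ (mul_ne_zero hb0 hq0), fracFun_div F _ _ _ hb0,
            fracFun_div F _ _ _ hq0]
          simp only [Derivation.leibniz, smul_eq_mul, map_add, map_sub, map_mul]
          field_simp
          ring })
    (by
      intro f g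
      change d.fracFun F (f * g) = f * d.fracFun F g + g * d.fracFun F f
      obtain ⟨a, b, hb, rfl⟩ := IsFractionRing.div_surjective (A := R) f
      obtain ⟨p, q, hq, rfl⟩ := IsFractionRing.div_surjective (A := R) g
      have hb0 : b ≠ 0 := nonZeroDivisors.ne_zero hb
      have hq0 : q ≠ 0 := nonZeroDivisors.ne_zero hq
      have hq' : algebraMap R F q ≠ 0 := by simpa using hq0
      have hb' : algebraMap R F b ≠ 0 := by simpa using hb0
      rw [div_mul_div_comm, ← map_mul, ← map_mul,
        fracFun_div F _ _ _ (mul_ne_zero hb0 hq0), fracFun_div F _ _ _ hb0,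
        fracFun_div F _ _ _ hq0]
      simp only [Derivation.leibniz, smul_eq_mul, map_add, map_sub, map_mul]
      field_simp
      ring)

end Derivation

/-! ### Formal pseudo-differential operators -/

/-- Formal pseudo-differential operators `∑_{k ≤ N} a_k D^k` (with `N` depending on the operator)
with coefficients `a_k` in `F`. -/
@[ext]
structure PsiDO (F : Type*) [Zero F] where
  /-- `coeff k` is the coefficient of `D^k`, written to the left of `D^k`. -/
  coeff : ℤ → F
  bounded' : ∃ N : ℤ, ∀ k, N < k → coeff k = 0

namespace PsiDO

variable {F : Type*} [CommRing F]

/-- Termwise difference. -/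
instance : Sub (PsiDO F) where
  sub A B := ⟨fun k => A.coeff k - B.coeff k, by
    obtain ⟨M, hM⟩ := A.bounded'
    obtain ⟨N, hN⟩ := B.bounded'
    refine ⟨max M N, fun k hk => ?_⟩
    rw [hM k (lt_of_le_of_lt (le_max_left _ _) hk), hN k (lt_of_le_of_lt (le_max_right _ _) hk),
      sub_zero]⟩

/-- The identity operator `D^0`. -/
instance : One (PsiDO F) where
  one := ⟨fun k => if k = 0 then 1 else 0, 0, fun k hk => by simp [hk.ne']⟩

section Mul

variable [Differential F]

/-- The contribution to the coefficient of `D^n` in `A ∘ B` of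
`(a_k D^k) ∘ (b_l D^l) = ∑_{j ≥ 0} binom(k, j) a_k b_l^{(j)} D^{k + l - j}`, for the indices `p = (k, j)` and
`l = n - k + j`. Here `binom(k, j) = k (k - 1) ⋯ (k - j + 1) / j!` for every integer `k`. -/
noncomputable def mulTerm (A B : PsiDO F) (n : ℤ) (p : ℤ × ℕ) : F :=
  (Ring.choose p.1 p.2 : ℤ) • (A.coeff p.1 *
    (fun f : F => f′)^[p.2] (B.coeff (n - p.1 + p.2)))

/-- Only finitely many terms contribute to each coefficient of a product. -/
theorem mulTerm_support_finite (A B : PsiDO F) (n : ℤ) :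
    (Function.support (mulTerm A B n)).Finite := by
  obtain ⟨M, hM⟩ := A.bounded'
  obtain ⟨N, hN⟩ := B.bounded'
  refine ((Set.finite_Icc (n - N) M).prod (Set.finite_Iic (M + N - n).toNat)).subset ?_
  rintro ⟨k, j⟩ h
  have h1 : k ≤ M := by
    by_contra hk
    exact h (by simp [mulTerm, hM k (not_le.mp hk)])
  have h2 : n - k + j ≤ N := by
    by_contra hk
    exact h (by simp [mulTerm, hN _ (not_le.mp hk)])
  simp only [Set.mem_prod, Set.mem_Icc, Set.mem_Iic]
  omega

/-- Composition of pseudo-differential operators, determined by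
`D^k ∘ f = ∑_{j ≥ 0} binom(k, j) f^{(j)} D^{k - j}` for `k ∈ ℤ`. All the sums are finite. -/
noncomputable instance : Mul (PsiDO F) where
  mul A B := ⟨fun n => ∑ᶠ p : ℤ × ℕ, mulTerm A B n p, by
    obtain ⟨M, hM⟩ := A.bounded'
    obtain ⟨N, hN⟩ := B.bounded'
    refine ⟨M + N, fun n hn => finsum_eq_zero_of_forall_eq_zero ?_⟩
    rintro ⟨k, j⟩
    by_cases hk : M < k
    · simp [mulTerm, hM k hk]
    · have : B.coeff (n - k + j) = 0 := hN _ (by omega)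
      simp [mulTerm, this]⟩

/-- Powers `A^m = A ∘ ⋯ ∘ A`, with `m` factors. -/
noncomputable instance : Pow (PsiDO F) ℕ where
  pow A m := Nat.rec 1 (fun _ B => A * B) m

/-- The commutator `[A, B] = A ∘ B - B ∘ A`. -/
noncomputable def commutator (A B : PsiDO F) : PsiDO F := A * B - B * A

/-- `P` is the square root `L^{1/2} = D + ∑_{k ≤ 0} p_k D^k` of `L`. -/
structure IsSqrt (P L : PsiDO F) : Prop where
  leading : P.coeff 1 = 1
  order_le : ∀ k, 1 < k → P.coeff k = 0
  mul_self : P * P = L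

end Mul

/-- The purely differential part `A_+ = ∑_{k ≥ 0} a_k D^k`. -/
noncomputable def plus (A : PsiDO F) : PsiDO F :=
  ⟨fun k => if 0 ≤ k then A.coeff k else 0, by
    obtain ⟨N, hN⟩ := A.bounded'
    exact ⟨N, fun k hk => by simp [hN k hk]⟩⟩

/-- The derivation `d` of `F` applied to each of the coefficients: for `d = ∂/∂t` this is
`∂A/∂t`. -/
def coeffDeriv (d : Derivation ℤ F F) (A : PsiDO F) : PsiDO F :=
  ⟨fun k => d (A.coeff k), by
    obtain ⟨N, hN⟩ := A.bounded'
    exact ⟨N, fun k hk => by simp [hN k hk]⟩⟩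

/-- The Schrödinger operator `D² + u`. -/
def schrodinger (u : F) : PsiDO F :=
  ⟨fun k => if k = 2 then 1 else if k = 0 then u else 0, 2, fun k hk => by
    simp [hk.ne', (show k ≠ 0 by omega)]⟩

end PsiDO

/-! ### The KdV hierarchy on rational functions

Polynomials in the odd-indexed variables `v₁, v₃, v₅, …` are `MvPolynomial ℕ K`, where `X k` is
the variable `v_{2k+1}`; so `X 0` is `x`. This ring is used for the variables `q` and for the times `t`. -/

namespace AdlerMoser

variable (K : Type*) [Field K]

/-- Rational functions in `x = t₁, t₃, t₅, …`. -/
def RatFun : Type _ := FractionRing (MvPolynomial ℕ K)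

noncomputable instance : Field (RatFun K) :=
  inferInstanceAs (Field (FractionRing (MvPolynomial ℕ K)))

noncomputable instance : Algebra (MvPolynomial ℕ K) (RatFun K) :=
  inferInstanceAs (Algebra (MvPolynomial ℕ K) (FractionRing (MvPolynomial ℕ K)))

instance : IsFractionRing (MvPolynomial ℕ K) (RatFun K) :=
  inferInstanceAs (IsFractionRing (MvPolynomial ℕ K) (FractionRing (MvPolynomial ℕ K)))

/-- The partial derivative `∂/∂t_{2k+1}` of rational functions. -/
noncomputable def dt (k : ℕ) : Derivation ℤ (RatFun K) (RatFun K) :=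
  (MvPolynomial.pderiv (R := K) k).frac (RatFun K)

/-- The space derivative is `D = ∂/∂x = ∂/∂t₁`. -/
noncomputable instance : Differential (RatFun K) := ⟨dt K 0⟩

variable {K}

/-- `u = 2 (log τ)''`, where `(log τ)' = τ' / τ`. -/
noncomputable def potential (τ : MvPolynomial ℕ K) : RatFun K :=
  2 * ((algebraMap _ (RatFun K) τ)′ / algebraMap _ (RatFun K) τ)′

/-- The Lax system of the KdV hierarchy for `L = D² + u`: the square root `L^{1/2}` exists and is
unique, and `∂L/∂t_m = [(L^{m/2})_+, L]` for all odd `m = 2k+1 ≥ 1`. -/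
def SatisfiesKdV (u : RatFun K) : Prop :=
  (∃! P : PsiDO (RatFun K), P.IsSqrt (PsiDO.schrodinger u)) ∧
  ∀ P : PsiDO (RatFun K), P.IsSqrt (PsiDO.schrodinger u) → ∀ k : ℕ,
    (PsiDO.schrodinger u).coeffDeriv (dt K k) =
      PsiDO.commutator (P ^ (2 * k + 1)).plus (PsiDO.schrodinger u)

/-! ### Power series in `z` -/

/-- `sinh z = ∑_{n odd} z^n / n!`. -/
def sinhSeries (A : Type*) [CommRing A] [Algebra ℚ A] : PowerSeries A :=
  PowerSeries.mk fun n => if Odd n then algebraMap ℚ A (1 / n.factorial) else 0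

/-- `cosh z = ∑_{n even} z^n / n!`. -/
def coshSeries (A : Type*) [CommRing A] [Algebra ℚ A] : PowerSeries A :=
  PowerSeries.mk fun n => if Even n then algebraMap ℚ A (1 / n.factorial) else 0

/-- `tanh z = sinh z / cosh z`. -/
noncomputable def tanhSeries : PowerSeries ℚ := sinhSeries ℚ * (coshSeries ℚ)⁻¹

/-- `∑_{k ≥ 1} c_k z^{2k+1}`: odd powers, starting with `z³`. -/
def oddSeries {A : Type*} [CommRing A] (c : ℕ → A) : PowerSeries A :=
  PowerSeries.mk fun n => if Odd n ∧ 3 ≤ n then c (n / 2) else 0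

/-! ### The Adler–Moser polynomials -/

variable (K)

/-- `α_{2k+1} = (-1)^k 3² 5² ⋯ (2k-1)² (2k+1)`. -/
def alpha (k : ℕ) : K :=
  (-1) ^ k * (∏ j ∈ Finset.Icc 1 (k - 1), (2 * (j : K) + 1) ^ 2) * (2 * (k : K) + 1)

/-- `μ_n = ∏_{j=1}^n (2n-2j+1)^j`. -/
def mu (n : ℕ) : K := ∏ j ∈ Finset.Icc 1 n, (2 * ((n : K) - (j : K)) + 1) ^ j

variable {K}

/-- The Wronskian `det (∂_x^i f_j)_{0 ≤ i, j < n}` of `f_0, …, f_{n-1}`. -/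
noncomputable def wronskian (n : ℕ) (f : ℕ → MvPolynomial ℕ K) : MvPolynomial ℕ K :=
  Matrix.det (Matrix.of fun i j : Fin n =>
    (fun g => MvPolynomial.pderiv 0 g)^[(i : ℕ)] (f j))

variable (K) [CharZero K]

/-- `ψ_{k+1}`, where
`∑_{j ≥ 1} ψ_j z^{2j-1} = sinh (x z) + cosh (x z) ∑_{i ≥ 2} (q_{2i-1} / α_{2i-1}) z^{2i-1}`. -/
noncomputable def psi (k : ℕ) : MvPolynomial ℕ K :=
  PowerSeries.coeff (2 * k + 1)
    (PowerSeries.rescale (MvPolynomial.X 0) (sinhSeries (MvPolynomial ℕ K)) +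
      PowerSeries.rescale (MvPolynomial.X 0) (coshSeries (MvPolynomial ℕ K)) *
        oddSeries fun i => MvPolynomial.C (alpha K i)⁻¹ * MvPolynomial.X i)

/-- The Adler–Moser polynomial `θ_n(q₁, q₃, …, q_{2n-1}) = μ_n Wr(ψ₁, …, ψ_n)`. -/
noncomputable def theta (n : ℕ) : MvPolynomial ℕ K :=
  MvPolynomial.C (mu K n) * wronskian n (psi K)

/-! ### The change of variables -/

/-- `tanh (∑_{i ≥ 2} t_{2i-1} z^{2i-1})`, a power series in `z` over the polynomials in `t`. -/
noncomputable def tanhTimes : PowerSeries (MvPolynomial ℕ K) :=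
  PowerSeries.subst (oddSeries (MvPolynomial.X : ℕ → MvPolynomial ℕ K)) tanhSeries

/-- `q_{2k+1}` as a polynomial in the times: `q₁ = t₁ = x`, and for `k ≥ 1` it is `α_{2k+1}` times the
coefficient of `z^{2k+1}` in `tanh (∑_{i ≥ 2} t_{2i-1} z^{2i-1})`. -/
noncomputable def qOfT (k : ℕ) : MvPolynomial ℕ K :=
  if k = 0 then MvPolynomial.X 0
  else MvPolynomial.C (alpha K k) * PowerSeries.coeff (2 * k + 1) (tanhTimes K)

/-- `τ_n(t) = θ_n(q(t))`. -/
noncomputable def tau (n : ℕ) : MvPolynomial ℕ K := MvPolynomial.aeval (qOfT K) (theta K n)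

end AdlerMoser

/-! The proof is a Darboux chain starting from `D²`, combined with Sato's dressing argument.

The functions `f j = ψ_{j+1}` satisfy `f 0 = x` and `f (j+1)'' = f j`. Let `A_n` (`dress`) be the
monic differential operator of order `n` that kills `f 0, …, f (n-1)`. It is a product of factors `g
D g⁻¹`, where `g` runs through the pivots `g_i = A_i (f i)`, and `W_n = Wr(f 0, …, f (n-1))` is the
product of the first `n` pivots. Since `D²` preserves the span of the first `n` functions, `A_n D²`
is divisible on the right by `A_n` (`dress_mul_D_sq`): `A_n D² = L_n A_n` with `L_n = D² + 2 (log
W_n)''`.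

Recursion: `g_n` and `s = A_n (f (n+1))` satisfy `L_n g_n = 0` and `L_n s = g_n`, and `g_n g_{n+1}`
is their Wronskian, so `(g_n g_{n+1})' = g_n²` (`deriv_pivot_mul_pivot`). As `g_n = W_{n+1} / W_n`,
this is the Adler–Moser recursion up to constants. It also shows inductively that no pivot vanishes.
Adding a constant `c` to `f (n+1)` adds `c A_{n+1}(1) = (-1)^(n+1) c / g_n` to the last pivot, hence
`(-1)^(n+1) c W_n` to `W_{n+2}`; `μ` and `α` absorb the constants.

Change of variables: the coefficient of `z^(2k+1)` in `tanh T`, with `T = ∑ t_{2i-1} z^(2i-1)`, is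
`t_{2k+1}` plus a polynomial in earlier times, so the substitution is triangular.

KdV: with `Θ = tanh T` the generating series is `sinh (x z + T) / cosh T`. Hence `∂/∂t_{2k+1}` acts
on each `f j` as `D^(2k+1)`, up to combinations of `f 0, …, f j` whose coefficients do not involve
`x` (`dt_psiTimeRat`). It follows that `∂A_n/∂t + A_n D^m`, `m = 2k+1`, kills `f 0, …, f (n-1)` and
equals `Q A_n` with `Q` differential. The square root of `L_n` is `A_n D A_n⁻¹`, and `Q` is the
differential part of its `m`-th power. Differentiating `A_n D² = L_n A_n` gives the Lax equation
(`lax_equation`). -/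

namespace PsiDO

variable {F : Type*} [CommRing F]

/-! ### The additive group of pseudo-differential operators -/

/-- The zero operator. -/
instance : Zero (PsiDO F) := ⟨⟨fun _ => 0, 0, fun _ _ => rfl⟩⟩

/-- Termwise sum. -/
instance : Add (PsiDO F) where
  add A B := ⟨fun k => A.coeff k + B.coeff k, by
    obtain ⟨M, hM⟩ := A.bounded'
    obtain ⟨N, hN⟩ := B.bounded'
    refine ⟨max M N, fun k hk => ?_⟩
    rw [hM k (lt_of_le_of_lt (le_max_left _ _) hk), hN k (lt_of_le_of_lt (le_max_right _ _) hk),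
      add_zero]⟩

/-- Termwise negation. -/
instance : Neg (PsiDO F) where
  neg A := ⟨fun k => -A.coeff k, by
    obtain ⟨M, hM⟩ := A.bounded'
    exact ⟨M, fun k hk => by rw [hM k hk, neg_zero]⟩⟩

/-- Termwise natural multiples. -/
instance : SMul ℕ (PsiDO F) where
  smul m A := ⟨fun k => m • A.coeff k, by
    obtain ⟨M, hM⟩ := A.bounded'
    exact ⟨M, fun k hk => by rw [hM k hk, smul_zero]⟩⟩

/-- Termwise integer multiples. -/
instance : SMul ℤ (PsiDO F) where
  smul m A := ⟨fun k => m • A.coeff k, by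
    obtain ⟨M, hM⟩ := A.bounded'
    exact ⟨M, fun k hk => by rw [hM k hk, smul_zero]⟩⟩

theorem coeff_injective : Function.Injective (coeff : PsiDO F → ℤ → F) :=
  fun _ _ h => PsiDO.ext h

instance : AddCommGroup (PsiDO F) :=
  coeff_injective.addCommGroup coeff rfl (fun _ _ => rfl) (fun _ => rfl) (fun _ _ => rfl)
    (fun _ _ => rfl) (fun _ _ => rfl)

@[simp] theorem coeff_zero (k : ℤ) : (0 : PsiDO F).coeff k = 0 := rfl
@[simp] theorem coeff_add (A B : PsiDO F) (k : ℤ) :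
    (A + B).coeff k = A.coeff k + B.coeff k := rfl
@[simp] theorem coeff_sub (A B : PsiDO F) (k : ℤ) :
    (A - B).coeff k = A.coeff k - B.coeff k := rfl
theorem coeff_one (k : ℤ) : (1 : PsiDO F).coeff k = if k = 0 then 1 else 0 := rfl

/-- The coefficient of `D^k` as an additive map. -/
def coeffHom (k : ℤ) : PsiDO F →+ F where
  toFun A := A.coeff k
  map_zero' := rfl
  map_add' _ _ := rfl

@[simp] theorem coeff_sum {ι : Type*} (s : Finset ι) (A : ι → PsiDO F) (k : ℤ) :
    (∑ i ∈ s, A i).coeff k = ∑ i ∈ s, (A i).coeff k :=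
  map_sum (coeffHom k) A s

/-- The operator `a D^k`. -/
def mono (a : F) (k : ℤ) : PsiDO F :=
  ⟨fun n => if n = k then a else 0, k, fun _ hn => if_neg hn.ne'⟩

theorem coeff_mono (a : F) (k n : ℤ) : (mono a k).coeff n = if n = k then a else 0 := rfl

theorem one_eq_mono : (1 : PsiDO F) = mono 1 0 := rfl

/-- The operator has order at most `N`. -/
def OrderLE (A : PsiDO F) (N : ℤ) : Prop := ∀ k, N < k → A.coeff k = 0

theorem OrderLE.mono {A : PsiDO F} {M N : ℤ} (h : A.OrderLE M) (hMN : M ≤ N) : A.OrderLE N :=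
  fun k hk => h k (hMN.trans_lt hk)

theorem exists_orderLE (A : PsiDO F) : ∃ N, A.OrderLE N := A.bounded'

theorem orderLE_mono (a : F) (k : ℤ) : (PsiDO.mono a k).OrderLE k := fun _ hn => if_neg hn.ne'

theorem OrderLE.sub {A B : PsiDO F} {N : ℤ} (hA : A.OrderLE N) (hB : B.OrderLE N) :
    (A - B).OrderLE N := fun k hk => by rw [coeff_sub, hA k hk, hB k hk, sub_zero]

/-- Truncation: a statement that is additive in `A` and depends only on finitely many orders reduces
to monomials `a D^k`. -/
theorem exists_sum_mono_add (A : PsiDO F) (M : ℤ) :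
    ∃ (s : Finset ℤ) (R : PsiDO F), R.OrderLE M ∧ A = ∑ k ∈ s, PsiDO.mono (A.coeff k) k + R := by
  obtain ⟨N, hN⟩ := A.exists_orderLE
  refine ⟨Finset.Ioc M N, A - ∑ k ∈ Finset.Ioc M N, PsiDO.mono (A.coeff k) k, ?_, by abel⟩
  intro k hk
  rw [coeff_sub, coeff_sum]
  simp only [coeff_mono, Finset.sum_ite_eq, Finset.mem_Ioc]
  by_cases h : k ≤ N
  · simp [hk, h]
  · simp [h, hN k (not_le.mp h)]

theorem mono_add (a b : F) (k : ℤ) : mono (a + b) k = mono a k + mono b k := by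
  ext n
  rw [coeff_add, coeff_mono, coeff_mono, coeff_mono]
  split_ifs <;> simp

theorem mono_zero (k : ℤ) : mono (0 : F) k = 0 := by
  ext n
  rw [coeff_mono, ite_self, coeff_zero]

theorem schrodinger_eq (u : F) : schrodinger u = mono 1 2 + mono u 0 := by
  ext n
  rw [coeff_add, coeff_mono, coeff_mono]
  change (if n = 2 then 1 else if n = 0 then u else 0) = _
  by_cases h : n = 2
  · simp [h]
  · simp [h]

/-- The operator has no negative powers of `D`. -/
def IsDiff (A : PsiDO F) : Prop := ∀ k < 0, A.coeff k = 0

theorem isDiff_mono (a : F) {k : ℤ} (hk : 0 ≤ k) : (PsiDO.mono a k).IsDiff :=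
  fun _ hn => if_neg (by omega)

theorem isDiff_one : (1 : PsiDO F).IsDiff := isDiff_mono 1 le_rfl

theorem IsDiff.add {A B : PsiDO F} (hA : A.IsDiff) (hB : B.IsDiff) : (A + B).IsDiff :=
  fun k hk => by rw [coeff_add, hA k hk, hB k hk, add_zero]

theorem IsDiff.sub {A B : PsiDO F} (hA : A.IsDiff) (hB : B.IsDiff) : (A - B).IsDiff :=
  fun k hk => by rw [coeff_sub, hA k hk, hB k hk, sub_zero]

theorem IsDiff.coeffDeriv {A : PsiDO F} (hA : A.IsDiff) (d : Derivation ℤ F F) :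
    (A.coeffDeriv d).IsDiff := fun k hk => by
  change d (A.coeff k) = 0
  rw [hA k hk, map_zero]

@[simp] theorem coeff_coeffDeriv (d : Derivation ℤ F F) (A : PsiDO F) (k : ℤ) :
    (A.coeffDeriv d).coeff k = d (A.coeff k) := rfl

theorem coeffDeriv_mono (d : Derivation ℤ F F) (a : F) (k : ℤ) :
    (mono a k).coeffDeriv d = mono (d a) k := by
  ext n
  rw [coeff_coeffDeriv, coeff_mono, coeff_mono, apply_ite d, map_zero]

/-! ### Composition is bilinear -/

section Mul

variable [Differential F]

theorem iterate_deriv_add (j : ℕ) (f g : F) :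
    (fun f : F => f′)^[j] (f + g) = (fun f : F => f′)^[j] f + (fun f : F => f′)^[j] g := by
  induction j generalizing f g with
  | zero => rfl
  | succ j ih => simp only [Function.iterate_succ_apply, map_add, ih]

theorem iterate_deriv_zero (j : ℕ) : (fun f : F => f′)^[j] 0 = 0 := by
  induction j with
  | zero => rfl
  | succ j ih => simp only [Function.iterate_succ_apply, map_zero, ih]

theorem iterate_deriv_one_succ (j : ℕ) : (fun f : F => f′)^[j + 1] 1 = 0 := by
  simp only [Function.iterate_succ_apply, Derivation.map_one_eq_zero, iterate_deriv_zero]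

theorem iterate_deriv_zsmul (j : ℕ) (m : ℤ) (f : F) :
    (fun f : F => f′)^[j] (m • f) = m • (fun f : F => f′)^[j] f := by
  induction j generalizing f with
  | zero => rfl
  | succ j ih => simp only [Function.iterate_succ_apply, map_zsmul, ih]

theorem iterate_deriv_mul (n : ℕ) (f g : F) :
    (fun f : F => f′)^[n] (f * g) = ∑ ij ∈ Finset.HasAntidiagonal.antidiagonal n,
      (n.choose ij.1 : F) * ((fun f : F => f′)^[ij.1] f * (fun f : F => f′)^[ij.2] g) := by
  induction n with
  | zero => simp
  | succ n ih =>
    rw [Function.iterate_succ_apply', ih, Finset.sum_antidiagonal_choose_succ_mul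
      (fun i j => (fun f : F => f′)^[i] f * (fun f : F => f′)^[j] g), ← Finset.sum_add_distrib,
      map_sum]
    refine Finset.sum_congr rfl fun ij hij => ?_
    rw [← Nat.choose_symm_of_eq_add (Finset.HasAntidiagonal.mem_antidiagonal.mp hij).symm]
    simp only [Derivation.leibniz, Derivation.map_natCast, smul_eq_mul,
      Function.iterate_succ_apply']
    ring

theorem mulTerm_def (A B : PsiDO F) (n k : ℤ) (j : ℕ) : mulTerm A B n (k, j) =
    (Ring.choose k j : ℤ) • (A.coeff k * (fun f : F => f′)^[j] (B.coeff (n - k + j))) := rfl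

theorem coeff_mul (A B : PsiDO F) (n : ℤ) :
    (A * B).coeff n = ∑ᶠ p : ℤ × ℕ, mulTerm A B n p := rfl

/-- The hypothesis on `Ring.choose k j` lets `s` omit the terms with `j > k ≥ 0`, which vanish
whatever the coefficients are. -/
theorem coeff_mul_eq_sum (A B : PsiDO F) (n : ℤ) (s : Finset (ℤ × ℕ))
    (h : ∀ (k : ℤ) (j : ℕ), A.coeff k ≠ 0 → B.coeff (n - k + j) ≠ 0 → (Ring.choose k j : ℤ) ≠ 0 → (k, j) ∈ s) :
    (A * B).coeff n = ∑ p ∈ s, mulTerm A B n p := by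
  rw [coeff_mul]
  refine finsum_eq_sum_of_support_subset _ ?_
  rintro ⟨k, j⟩ hp
  rw [Function.mem_support, mulTerm_def] at hp
  refine h k j ?_ ?_ ?_
  · intro h0; simp [h0] at hp
  · intro h0; simp [h0] at hp
  · intro h0; simp [h0] at hp

theorem add_mul' (A B C : PsiDO F) : (A + B) * C = A * C + B * C := by
  ext n
  rw [coeff_add, coeff_mul, coeff_mul, coeff_mul, ← finsum_add_distrib
    (mulTerm_support_finite A C n) (mulTerm_support_finite B C n)]
  refine finsum_congr fun p => ?_
  simp only [mulTerm, coeff_add, add_mul, smul_add]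

theorem mul_add' (A B C : PsiDO F) : A * (B + C) = A * B + A * C := by
  ext n
  rw [coeff_add, coeff_mul, coeff_mul, coeff_mul, ← finsum_add_distrib
    (mulTerm_support_finite A B n) (mulTerm_support_finite A C n)]
  refine finsum_congr fun p => ?_
  simp only [mulTerm, coeff_add, mul_add, smul_add, iterate_deriv_add]

theorem zero_mul' (A : PsiDO F) : 0 * A = 0 := by
  have h := add_mul' 0 0 A
  rw [add_zero] at h
  exact left_eq_add.mp h

theorem mul_zero' (A : PsiDO F) : A * 0 = 0 := by
  have h := mul_add' A 0 0
  rw [add_zero] at h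
  exact left_eq_add.mp h

theorem OrderLE.mul {A B : PsiDO F} {M N : ℤ} (hA : A.OrderLE M) (hB : B.OrderLE N) :
    (A * B).OrderLE (M + N) := by
  intro n hn
  rw [coeff_mul_eq_sum A B n ∅ ?_, Finset.sum_empty]
  intro k j hk hj _
  have h1 : k ≤ M := not_lt.mp fun h => hk (hA k h)
  have h2 : n - k + j ≤ N := not_lt.mp fun h => hj (hB _ h)
  omega

/-! ### Composition is associative -/

theorem coeff_mono_mul_mono (a b : F) (k l n : ℤ) (j : ℕ) (hj : n + j = k + l) :
    (mono a k * mono b l).coeff n = (Ring.choose k j : ℤ) • (a * (fun f : F => f′)^[j] b) := by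
  rw [coeff_mul_eq_sum _ _ n {(k, j)}, Finset.sum_singleton, mulTerm_def, coeff_mono, coeff_mono,
    if_pos rfl, if_pos (by omega)]
  intro k' j' h1 h2 _
  rw [coeff_mono, Ne, ite_eq_right_iff, Classical.not_imp] at h1 h2
  rw [Finset.mem_singleton, Prod.mk.injEq]
  omega

theorem sum_antidiagonal_assoc {M : Type*} [AddCommMonoid M] (n : ℕ) (f : ℕ → ℕ → ℕ → M) :
    ∑ p ∈ Finset.HasAntidiagonal.antidiagonal n, ∑ r ∈ Finset.HasAntidiagonal.antidiagonal p.1, f r.1 r.2 p.2 =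
      ∑ p ∈ Finset.HasAntidiagonal.antidiagonal n, ∑ r ∈ Finset.HasAntidiagonal.antidiagonal p.2, f p.1 r.1 r.2 := by
  rw [Finset.sum_sigma', Finset.sum_sigma']
  refine Finset.sum_nbij' (fun x => ⟨(x.2.1, x.2.2 + x.1.2), (x.2.2, x.1.2)⟩)
    (fun x => ⟨(x.1.1 + x.2.1, x.2.2), (x.1.1, x.2.1)⟩) ?_ ?_ ?_ ?_ fun _ _ => rfl
  all_goals
    rintro ⟨⟨a, b⟩, ⟨c, d⟩⟩ h
    simp only [Finset.mem_sigma, Finset.HasAntidiagonal.mem_antidiagonal] at h ⊢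
    obtain ⟨h1, h2⟩ := h
    subst h2
    subst h1
    simp only [add_assoc, and_self]

/-- On the left, `a b^{(i)} c^{(j)}` has coefficient `binom(k, i) binom(k + l - i, j)`. On the
right, after the Leibniz rule, it has `∑_{s + t = j} binom(k, i) binom(k - i, s) binom(l, t)`. The
two agree by Chu–Vandermonde. -/
theorem mono_mul_assoc (a b c : F) (k l m : ℤ) :
    mono a k * mono b l * mono c m = mono a k * (mono b l * mono c m) := by
  ext n
  by_cases hn : n ≤ k + l + m
  swap
  · rw [((orderLE_mono a k).mul (orderLE_mono b l)).mul (orderLE_mono c m) n (not_le.mp hn),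
      (orderLE_mono a k).mul ((orderLE_mono b l).mul (orderLE_mono c m)) n (by omega)]
  obtain ⟨N, hN⟩ := Int.eq_ofNat_of_zero_le (sub_nonneg.mpr hn)
  have e1 : (mono a k * mono b l * mono c m).coeff n =
      ∑ p ∈ Finset.HasAntidiagonal.antidiagonal N, (Ring.choose (k + l - p.1) p.2 : ℤ) •
        (((Ring.choose k p.1 : ℤ) • (a * (fun f : F => f′)^[p.1] b)) *
          (fun f : F => f′)^[p.2] c) := by
    rw [coeff_mul_eq_sum _ _ n ((Finset.HasAntidiagonal.antidiagonal N).image fun p => (k + l - (p.1 : ℤ), p.2))]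
    · rw [Finset.sum_image]
      · refine Finset.sum_congr rfl fun p hp => ?_
        rw [Finset.HasAntidiagonal.mem_antidiagonal] at hp
        rw [mulTerm_def, coeff_mono_mul_mono a b k l _ p.1 (by omega), coeff_mono,
          if_pos (by omega)]
      · rintro ⟨p, q⟩ _ ⟨p', q'⟩ _ h
        simp only [Prod.mk.injEq] at h ⊢
        omega
    · intro r j h1 h2 _
      have h3 : r ≤ k + l := not_lt.mp fun h => h1 (((orderLE_mono a k).mul (orderLE_mono b l)) _ h)
      rw [coeff_mono, Ne, ite_eq_right_iff, Classical.not_imp] at h2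
      refine Finset.mem_image.mpr ⟨((k + l - r).toNat, j), ?_, ?_⟩
      · rw [Finset.HasAntidiagonal.mem_antidiagonal]; dsimp only; omega
      · rw [Prod.mk.injEq]; exact ⟨by dsimp only; omega, rfl⟩
  have e2 : (mono a k * (mono b l * mono c m)).coeff n =
      ∑ p ∈ Finset.HasAntidiagonal.antidiagonal N, (Ring.choose k p.1 : ℤ) •
        (a * (fun f : F => f′)^[p.1]
          ((Ring.choose l p.2 : ℤ) • (b * (fun f : F => f′)^[p.2] c))) := by
    rw [coeff_mul_eq_sum _ _ n ((Finset.HasAntidiagonal.antidiagonal N).image fun p => (k, p.1))]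
    · rw [Finset.sum_image]
      · refine Finset.sum_congr rfl fun p hp => ?_
        rw [Finset.HasAntidiagonal.mem_antidiagonal] at hp
        rw [mulTerm_def, coeff_mono_mul_mono b c l m _ p.2 (by omega), coeff_mono, if_pos rfl]
      · rintro ⟨p, q⟩ hp ⟨p', q'⟩ hp' h
        simp only [Prod.mk.injEq, Finset.mem_coe,
          Finset.HasAntidiagonal.mem_antidiagonal] at h hp hp' ⊢
        omega
    · intro r j h1 h2 _
      have h3 : n - r + j ≤ l + m :=
        not_lt.mp fun h => h2 (((orderLE_mono b l).mul (orderLE_mono c m)) _ h)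
      rw [coeff_mono, Ne, ite_eq_right_iff, Classical.not_imp] at h1
      refine Finset.mem_image.mpr ⟨(j, N - j), ?_, ?_⟩
      · rw [Finset.HasAntidiagonal.mem_antidiagonal]; dsimp only; omega
      · rw [Prod.mk.injEq]; exact ⟨h1.1.symm, rfl⟩
  rw [e1, e2]
  have e3 : ∀ p ∈ Finset.HasAntidiagonal.antidiagonal N, (Ring.choose k p.1 : ℤ) •
        (a * (fun f : F => f′)^[p.1]
          ((Ring.choose l p.2 : ℤ) • (b * (fun f : F => f′)^[p.2] c))) =
      ∑ r ∈ Finset.HasAntidiagonal.antidiagonal p.1,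
        ((Ring.choose k r.1 * Ring.choose (k - r.1) r.2 * Ring.choose l p.2 : ℤ) : F) *
          (a * (fun f : F => f′)^[r.1] b * (fun f : F => f′)^[r.2 + p.2] c) := by
    intro p _
    rw [iterate_deriv_zsmul, iterate_deriv_mul, Finset.smul_sum, Finset.mul_sum, Finset.smul_sum]
    refine Finset.sum_congr rfl fun r hr => ?_
    rw [Finset.HasAntidiagonal.mem_antidiagonal] at hr
    -- The binomial coefficient of the Leibniz rule merges with `binom(k, p.1)` into `binom(k, r.1)
    -- binom(k - r.1, r.2)`.
    have hc := Ring.choose_smul_choose k (n := p.1) (k := r.1) (by omega)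
    rw [show p.1 - r.1 = r.2 by omega, nsmul_eq_mul] at hc
    rw [← hc, Function.iterate_add_apply]
    simp only [zsmul_eq_mul]
    push_cast
    ring
  rw [Finset.sum_congr rfl e3, sum_antidiagonal_assoc N (fun r s t =>
    ((Ring.choose k r * Ring.choose (k - r) s * Ring.choose l t : ℤ) : F) *
          (a * (fun f : F => f′)^[r] b * (fun f : F => f′)^[s + t] c))]
  refine Finset.sum_congr rfl fun p _ => ?_
  have e4 : ∀ r ∈ Finset.HasAntidiagonal.antidiagonal p.2,
      ((Ring.choose k p.1 * Ring.choose (k - p.1) r.1 * Ring.choose l r.2 : ℤ) : F) *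
          (a * (fun f : F => f′)^[p.1] b * (fun f : F => f′)^[r.1 + r.2] c) =
      ((Ring.choose (k - p.1) r.1 * Ring.choose l r.2 : ℤ) : F) * ((Ring.choose k p.1 : ℤ) *
          (a * (fun f : F => f′)^[p.1] b * (fun f : F => f′)^[p.2] c)) := by
    intro r hr
    rw [Finset.HasAntidiagonal.mem_antidiagonal.mp hr]
    push_cast
    ring
  rw [Finset.sum_congr rfl e4, ← Finset.sum_mul, ← Int.cast_sum,
    ← Ring.add_choose_eq p.2 (Commute.all _ _), show k - (p.1 : ℤ) + l = k + l - p.1 by ring]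
  simp only [zsmul_eq_mul]
  ring

/-- The triple products `(A B) C - A (B C)`. -/
noncomputable def associator' (A B C : PsiDO F) : PsiDO F := A * B * C - A * (B * C)

theorem OrderLE.associator' {A B C : PsiDO F} {M N P : ℤ} (hA : A.OrderLE M) (hB : B.OrderLE N)
    (hC : C.OrderLE P) : (associator' A B C).OrderLE (M + N + P) :=
  ((hA.mul hB).mul hC).sub ((hA.mul (hB.mul hC)).mono (by omega))

theorem associator'_add_left (A A' B C : PsiDO F) :
    associator' (A + A') B C = associator' A B C + associator' A' B C := by
  simp only [associator', add_mul']; abel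

theorem associator'_add_mid (A B B' C : PsiDO F) :
    associator' A (B + B') C = associator' A B C + associator' A B' C := by
  simp only [associator', add_mul', mul_add']; abel

theorem associator'_add_right (A B C C' : PsiDO F) :
    associator' A B (C + C') = associator' A B C + associator' A B C' := by
  simp only [associator', mul_add']; abel

/-- The coefficient of `D^n` in the associator sees only finitely many coefficients of each factor.
Each cutoff below is chosen so that the discarded tail contributes an associator of order at most `n
- 1`; additivity then leaves only monomials. -/
theorem mul_assoc' (A B C : PsiDO F) : A * B * C = A * (B * C) := by
  rw [← sub_eq_zero]
  change associator' A B C = 0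
  obtain ⟨M, hM⟩ := A.exists_orderLE
  obtain ⟨N, hN⟩ := B.exists_orderLE
  obtain ⟨P, hP⟩ := C.exists_orderLE
  ext n
  obtain ⟨s, R, hR, hA⟩ := A.exists_sum_mono_add (n - 1 - N - P)
  set A₁ := ∑ k ∈ s, mono (A.coeff k) k with hA₁
  have eA : (associator' A B C).coeff n = (associator' A₁ B C).coeff n := by
    rw [hA, associator'_add_left, coeff_add, hR.associator' hN hP n (by omega), add_zero]
  let φ (B C : PsiDO F) : PsiDO F →+ PsiDO F :=
    AddMonoidHom.mk' (fun A => associator' A B C) fun _ _ => associator'_add_left _ _ _ _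
  let χ (A C : PsiDO F) : PsiDO F →+ PsiDO F :=
    AddMonoidHom.mk' (fun B => associator' A B C) fun _ _ => associator'_add_mid _ _ _ _
  let ω (A B : PsiDO F) : PsiDO F →+ PsiDO F :=
    AddMonoidHom.mk' (fun C => associator' A B C) fun _ _ => associator'_add_right _ _ _ _
  rw [eA, coeff_zero, hA₁]
  change (φ B C _).coeff n = 0
  rw [map_sum, coeff_sum]
  refine Finset.sum_eq_zero fun k _ => ?_
  change (associator' (mono (A.coeff k) k) B C).coeff n = 0
  generalize A.coeff k = a
  obtain ⟨s', R', hR', hB⟩ := B.exists_sum_mono_add (n - 1 - k - P)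
  rw [hB, associator'_add_mid, coeff_add, (orderLE_mono a k).associator' hR' hP n (by omega),
    add_zero]
  change (χ _ C _).coeff n = 0
  rw [map_sum, coeff_sum]
  refine Finset.sum_eq_zero fun l _ => ?_
  change (associator' (mono a k) (mono (B.coeff l) l) C).coeff n = 0
  generalize B.coeff l = b
  obtain ⟨s'', R'', hR'', hC⟩ := C.exists_sum_mono_add (n - 1 - k - l)
  rw [hC, associator'_add_right, coeff_add,
    (orderLE_mono a k).associator' (orderLE_mono b l) hR'' n (by omega), add_zero]
  change (ω _ _ _).coeff n = 0
  rw [map_sum, coeff_sum]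
  refine Finset.sum_eq_zero fun m _ => ?_
  change (associator' (mono a k) (mono b l) (mono (C.coeff m) m)).coeff n = 0
  rw [associator', mono_mul_assoc, sub_self, coeff_zero]

/-! ### The ring of pseudo-differential operators -/

theorem coeff_mono_zero_mul (a : F) (B : PsiDO F) (n : ℤ) :
    (mono a 0 * B).coeff n = a * B.coeff n := by
  rw [coeff_mul_eq_sum _ _ n {(0, 0)}, Finset.sum_singleton, mulTerm_def]
  · simp [coeff_mono]
  · intro k j h1 _ h3
    rw [coeff_mono, Ne, ite_eq_right_iff, Classical.not_imp] at h1
    obtain ⟨rfl, _⟩ := h1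
    rcases j with _ | j
    · simp
    · exact absurd (Ring.choose_zero_succ ℤ j) h3

theorem coeff_mono_one_mul (a : F) (B : PsiDO F) (n : ℤ) :
    (mono a 1 * B).coeff n = a * (B.coeff (n - 1) + (B.coeff n)′) := by
  rw [coeff_mul_eq_sum _ _ n {(1, 0), (1, 1)}, Finset.sum_pair (by simp), mulTerm_def, mulTerm_def]
  · simp [coeff_mono, mul_add]
  · intro k j h1 _ h3
    rw [coeff_mono, Ne, ite_eq_right_iff, Classical.not_imp] at h1
    obtain ⟨rfl, _⟩ := h1
    rcases j with _ | _ | j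
    · simp
    · simp
    · refine absurd ?_ h3
      rw [← Nat.cast_one, Ring.choose_natCast, Nat.choose_eq_zero_of_lt (by omega), Nat.cast_zero]

theorem coeff_mul_mono_one (A : PsiDO F) (l n : ℤ) :
    (A * mono 1 l).coeff n = A.coeff (n - l) := by
  rw [coeff_mul, finsum_eq_single _ (n - l, 0), mulTerm_def]
  · simp [coeff_mono]
  · rintro ⟨k, j⟩ h
    rw [mulTerm_def, coeff_mono]
    rcases j with _ | j
    · rw [if_neg fun h' => h (by rw [Prod.mk.injEq]; exact ⟨by push_cast at h'; omega, rfl⟩),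
        iterate_deriv_zero, mul_zero, smul_zero]
    · split_ifs
      · rw [iterate_deriv_one_succ, mul_zero, smul_zero]
      · rw [iterate_deriv_zero, mul_zero, smul_zero]

theorem one_mul' (A : PsiDO F) : 1 * A = A := by
  ext n
  rw [one_eq_mono, coeff_mono_zero_mul, one_mul]

theorem mul_one' (A : PsiDO F) : A * 1 = A := by
  ext n
  rw [one_eq_mono, coeff_mul_mono_one, sub_zero]

theorem pow_succ_left (A : PsiDO F) (m : ℕ) : A ^ (m + 1) = A * A ^ m := rfl

/-- `npow` is the power already defined, which multiplies on the left, so that ring powers agree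
with it definitionally. -/
noncomputable instance : Ring (PsiDO F) :=
  { (inferInstance : AddCommGroup (PsiDO F)) with
    mul := (· * ·)
    one := 1
    left_distrib := mul_add'
    right_distrib := add_mul'
    zero_mul := zero_mul'
    mul_zero := mul_zero'
    mul_assoc := mul_assoc'
    one_mul := one_mul'
    mul_one := mul_one'
    npow := fun m A => A ^ m
    npow_zero := fun _ => rfl
    npow_succ := fun m A => by
      induction m with
      | zero => exact (mul_one' A).trans (one_mul' A).symm
      | succ m ih => rw [pow_succ_left, ih, ← mul_assoc', ← pow_succ_left, ih] }

end Mul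

end PsiDO

namespace PsiDO

variable {F : Type*} [CommRing F] [Differential F]

/-! ### Monomial operators -/

theorem mono_mul_mono_one (a : F) (k l : ℤ) : mono a k * mono 1 l = mono a (k + l) := by
  ext n
  rw [coeff_mul_mono_one, coeff_mono, coeff_mono]
  exact if_congr (by omega) rfl rfl

theorem mono_zero_mul_mono (a b : F) (k : ℤ) : mono a 0 * mono b k = mono (a * b) k := by
  ext n
  rw [coeff_mono_zero_mul, coeff_mono, coeff_mono, mul_ite, mul_zero]

theorem coeff_mono_two_mul (a : F) (B : PsiDO F) (n : ℤ) :
    (mono a 2 * B).coeff n = a * (B.coeff (n - 2) + 2 * (B.coeff (n - 1))′ + (B.coeff n)′′) := by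
  rw [show mono a 2 = mono a 1 * mono 1 1 from (mono_mul_mono_one a 1 1).symm, mul_assoc,
    coeff_mono_one_mul, coeff_mono_one_mul, coeff_mono_one_mul,
    show n - 1 - 1 = n - 2 by ring]
  simp only [one_mul, map_add]
  ring

theorem mul_mono_of_deriv_eq_zero (A : PsiDO F) {c : F} (hc : c′ = 0) :
    A * mono c 0 = mono c 0 * A := by
  ext n
  rw [coeff_mono_zero_mul, coeff_mul, finsum_eq_single _ (n, 0), mulTerm_def]
  · simp [coeff_mono, mul_comm]
  · rintro ⟨k, j⟩ h
    rw [mulTerm_def, coeff_mono]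
    rcases j with _ | j
    · rw [if_neg fun h' => h (by rw [Prod.mk.injEq]; exact ⟨by push_cast at h'; omega, rfl⟩),
        iterate_deriv_zero, mul_zero, smul_zero]
    · split_ifs
      · rw [Function.iterate_succ_apply, hc, iterate_deriv_zero, mul_zero, smul_zero]
      · rw [iterate_deriv_zero, mul_zero, smul_zero]

/-! ### Differential operators and their action on functions -/

/-- A contribution to a negative power of `D` would need `j > k ≥ 0`, where `binom(k, j) = 0`. -/
theorem IsDiff.mul {A B : PsiDO F} (hA : A.IsDiff) (hB : B.IsDiff) : (A * B).IsDiff := by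
  intro n hn
  rw [coeff_mul_eq_sum A B n ∅ ?_, Finset.sum_empty]
  intro k j hk hj hc
  have h1 : 0 ≤ k := not_lt.mp fun h => hk (hA k h)
  have h2 : 0 ≤ n - k + j := not_lt.mp fun h => hj (hB _ h)
  lift k to ℕ using h1
  rw [Ring.choose_natCast, Nat.choose_eq_zero_of_lt (by omega)] at hc
  exact absurd rfl hc

/-- The action of a differential operator on a function: the constant term of `A ∘ f`. -/
noncomputable def apply (A : PsiDO F) (f : F) : F := (A * PsiDO.mono f 0).coeff 0

/-- Write `C = c + E D` with `c` its constant term and `E` differential; then `A E D` has no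
constant term. -/
theorem coeff_zero_mul {A C : PsiDO F} (hA : A.IsDiff) (hC : C.IsDiff) :
    (A * C).coeff 0 = A.apply (C.coeff 0) := by
  have h : C = PsiDO.mono (C.coeff 0) 0 + (C - PsiDO.mono (C.coeff 0) 0) * PsiDO.mono 1 (-1) *
      PsiDO.mono 1 1 := by
    rw [mul_assoc, mono_mul_mono_one, neg_add_cancel, ← one_eq_mono, mul_one]
    abel
  have hE : ((C - PsiDO.mono (C.coeff 0) 0) * PsiDO.mono 1 (-1)).IsDiff := by
    intro k hk
    rw [coeff_mul_mono_one, coeff_sub, coeff_mono]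
    rcases (show k - -1 ≤ 0 by omega).lt_or_eq with h | h
    · rw [hC _ h, if_neg h.ne, sub_zero]
    · rw [h, if_pos rfl, sub_self]
  conv_lhs => rw [h]
  rw [mul_add, coeff_add, ← mul_assoc, coeff_mul_mono_one, hA.mul hE _ (by omega), add_zero]
  rfl

theorem apply_mul {A B : PsiDO F} (hA : A.IsDiff) (hB : B.IsDiff) (f : F) :
    (A * B).apply f = A.apply (B.apply f) := by
  rw [apply, mul_assoc, coeff_zero_mul hA (hB.mul (isDiff_mono f le_rfl))]
  rfl

theorem add_apply (A B : PsiDO F) (f : F) : (A + B).apply f = A.apply f + B.apply f := by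
  rw [apply, add_mul]; rfl

theorem sub_apply (A B : PsiDO F) (f : F) : (A - B).apply f = A.apply f - B.apply f := by
  rw [apply, sub_mul]; rfl

theorem one_apply (f : F) : (1 : PsiDO F).apply f = f := by
  rw [apply, one_mul, coeff_mono, if_pos rfl]

theorem apply_add (A : PsiDO F) (f g : F) : A.apply (f + g) = A.apply f + A.apply g := by
  rw [apply, mono_add, mul_add]; rfl

theorem apply_zero (A : PsiDO F) : A.apply 0 = 0 := by
  rw [apply, mono_zero, mul_zero, coeff_zero]

theorem apply_sum (A : PsiDO F) {ι : Type*} (s : Finset ι) (f : ι → F) :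
    A.apply (∑ i ∈ s, f i) = ∑ i ∈ s, A.apply (f i) :=
  map_sum (AddMonoidHom.mk' A.apply A.apply_add) f s

theorem mono_zero_apply (a f : F) : (PsiDO.mono a 0).apply f = a * f := by
  rw [apply, coeff_mono_zero_mul, coeff_mono, if_pos rfl]

theorem mono_one_apply (a f : F) : (PsiDO.mono a 1).apply f = a * f′ := by
  rw [apply, coeff_mono_one_mul, coeff_mono, coeff_mono, if_neg (by omega), if_pos rfl, zero_add]

theorem mono_natCast_apply (k : ℕ) (f : F) :
    (PsiDO.mono 1 k : PsiDO F).apply f = (fun f : F => f′)^[k] f := by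
  induction k with
  | zero => exact one_apply f
  | succ k ih =>
    rw [Nat.cast_succ, add_comm, ← mono_mul_mono_one,
      apply_mul (isDiff_mono _ zero_le_one) (isDiff_mono _ (by omega)), ih, mono_one_apply, one_mul,
      Function.iterate_succ_apply']

theorem apply_mul_of_deriv_eq_zero (A : PsiDO F) {c : F} (hc : c′ = 0) (f : F) :
    A.apply (c * f) = c * A.apply f := by
  rw [apply, ← mono_zero_mul_mono, ← mul_assoc, mul_mono_of_deriv_eq_zero A hc, mul_assoc,
    coeff_mono_zero_mul]
  rfl

theorem schrodinger_apply (u f : F) : (schrodinger u).apply f = f′′ + u * f := by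
  rw [schrodinger_eq, add_apply, mono_zero_apply]
  congr 1
  exact mono_natCast_apply 2 f

theorem apply_eq_sum {A : PsiDO F} (hA : A.IsDiff) {n : ℕ} (hn : A.OrderLE n) (f : F) :
    A.apply f = ∑ k ∈ Finset.range (n + 1), A.coeff k * (fun f : F => f′)^[k] f := by
  rw [apply, coeff_mul_eq_sum _ _ 0 ((Finset.range (n + 1)).image fun k : ℕ => ((k : ℤ), k))]
  · rw [Finset.sum_image fun a _ b _ h => (Prod.mk.inj h).2]
    refine Finset.sum_congr rfl fun k _ => ?_
    rw [mulTerm_def, coeff_mono, if_pos (by omega), Ring.choose_natCast, Nat.choose_self,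
      Nat.cast_one, one_smul]
  · intro k j hk hj _
    have h1 : 0 ≤ k := not_lt.mp fun h => hk (hA k h)
    have h2 : k ≤ n := not_lt.mp fun h => hk (hn k h)
    rw [coeff_mono, Ne, ite_eq_right_iff, Classical.not_imp] at hj
    refine Finset.mem_image.mpr ⟨j, Finset.mem_range.mpr (by omega), ?_⟩
    rw [Prod.mk.injEq]
    exact ⟨by omega, rfl⟩

/-! ### Differentiation of the coefficients -/

/-- The composition involves iterated `x`-derivatives of the coefficients of `B`, so `d` has to
commute with `′`. -/
theorem coeffDeriv_mul {d : Derivation ℤ F F} (hd : ∀ f : F, d f′ = (d f)′) (A B : PsiDO F) :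
    (A * B).coeffDeriv d = A.coeffDeriv d * B + A * B.coeffDeriv d := by
  have hiter : ∀ (j : ℕ) (f : F), d ((fun f : F => f′)^[j] f) = (fun f : F => f′)^[j] (d f) := by
    intro j
    induction j with
    | zero => exact fun _ => rfl
    | succ j ih => intro f; rw [Function.iterate_succ_apply, ih, hd]; rfl
  ext n
  rw [coeff_add, coeff_coeffDeriv, coeff_mul, coeff_mul, coeff_mul, ← finsum_add_distrib
    (mulTerm_support_finite _ _ n) (mulTerm_support_finite _ _ n)]
  refine ((d : F →+ F).map_finsum (mulTerm_support_finite A B n)).trans (finsum_congr fun p => ?_)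
  change d (mulTerm A B n p) = _
  simp only [mulTerm, map_zsmul, Derivation.leibniz, smul_eq_mul, hiter, coeff_coeffDeriv,
    ← smul_add]
  congr 1
  ring

theorem deriv_apply {d : Derivation ℤ F F} (hd : ∀ f : F, d f′ = (d f)′) (A : PsiDO F) (f : F) :
    d (A.apply f) = (A.coeffDeriv d).apply f + A.apply (d f) := by
  rw [apply, ← coeff_coeffDeriv, coeffDeriv_mul hd, coeffDeriv_mono]
  rfl

/-! ### Square roots -/

theorem OrderLE.coeff_mul {A B : PsiDO F} {M N : ℤ} (hA : A.OrderLE M) (hB : B.OrderLE N) :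
    (A * B).coeff (M + N) = A.coeff M * B.coeff N := by
  rw [coeff_mul_eq_sum A B _ {(M, 0)}, Finset.sum_singleton, mulTerm_def]
  · simp
  · intro k j hk hj _
    have h1 : k ≤ M := not_lt.mp fun h => hk (hA k h)
    have h2 : M + N - k + j ≤ N := not_lt.mp fun h => hj (hB _ h)
    rw [Finset.mem_singleton, Prod.mk.injEq]
    omega

/-- From `P² = Q²` follows `P (P - Q) + (P - Q) Q = 0`. If `P - Q` has order at most `-m`, the
coefficient of `D^(1-m)` here is twice its coefficient at `D^(-m)`, which therefore vanishes; so the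
order drops indefinitely. -/
theorem IsSqrt.unique {F : Type*} [Field F] [CharZero F] [Differential F] {P Q L : PsiDO F}
    (hP : P.IsSqrt L) (hQ : Q.IsSqrt L) : P = Q := by
  have hP1 : P.OrderLE 1 := hP.order_le
  have hQ1 : Q.OrderLE 1 := hQ.order_le
  have key : ∀ m : ℕ, (P - Q).OrderLE (-m) := by
    intro m
    induction m with
    | zero =>
      intro k hk
      rcases (show 1 ≤ k by omega).lt_or_eq with h | rfl
      · rw [coeff_sub, hP1 k h, hQ1 k h, sub_zero]
      · rw [coeff_sub, hP.leading, hQ.leading, sub_self]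
    | succ m ih =>
      intro k hk
      rcases (show -(m : ℤ) ≤ k by push_cast at hk; omega).lt_or_eq with h | rfl
      · exact ih k h
      · have h0 : P * (P - Q) + (P - Q) * Q = 0 := by
          rw [mul_sub, sub_mul, hP.mul_self, hQ.mul_self]; abel
        have h1 := congrArg (fun A : PsiDO F => A.coeff (1 + -(m : ℤ))) h0
        simp only [coeff_add] at h1
        rw [hP1.coeff_mul ih, add_comm (1 : ℤ), ih.coeff_mul hQ1, hP.leading, hQ.leading,
          one_mul, mul_one, coeff_zero, ← two_mul] at h1
        exact (mul_eq_zero.mp h1).resolve_left two_ne_zero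
  ext k
  refine sub_eq_zero.mp (key (k.natAbs + 1) k (by omega))

end PsiDO

namespace PsiDO

variable {F : Type*} [Field F] [Differential F]

/-! ### Darboux chains -/

/-- The first order operator `g D g⁻¹`, which annihilates `g`. -/
def darbouxFactor (g : F) : PsiDO F := mono 1 1 - mono (Differential.logDeriv g) 0

/-- The operator `g D⁻¹ g⁻¹`. -/
noncomputable def darbouxFactorInv (g : F) : PsiDO F := mono g (-1) * mono g⁻¹ 0

theorem darbouxFactor_eq {g : F} (hg : g ≠ 0) : darbouxFactor g = mono g 1 * mono g⁻¹ 0 := by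
  ext n
  rw [coeff_mono_one_mul, darbouxFactor, coeff_sub, coeff_mono, coeff_mono, coeff_mono, coeff_mono]
  by_cases h1 : n = 1
  · simp [h1, hg]
  by_cases h0 : n = 0
  · have := Derivation.leibniz_inv (Differential.deriv : Derivation ℤ F F) g
    simp only [h0, Int.reduceEq, zero_sub, if_false, if_true, this, Differential.logDeriv,
      zero_add, smul_eq_mul]
    field_simp
  · simp [h1, h0, show n - 1 ≠ 0 by omega]

theorem darbouxFactor_mul_inv {g : F} (hg : g ≠ 0) :
    darbouxFactor g * darbouxFactorInv g = 1 := by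
  have e : (mono g⁻¹ 0 * mono g (-1) : PsiDO F) = mono 1 (-1) := by
    rw [mono_zero_mul_mono, inv_mul_cancel₀ hg]
  rw [darbouxFactor_eq hg, darbouxFactorInv, mul_assoc, ← mul_assoc (mono g⁻¹ 0), e, ← mul_assoc,
    mono_mul_mono_one, add_neg_cancel, mono_zero_mul_mono, mul_inv_cancel₀ hg, one_eq_mono]

theorem darbouxFactorInv_mul {g : F} (hg : g ≠ 0) :
    darbouxFactorInv g * darbouxFactor g = 1 := by
  have e : (mono g⁻¹ 0 * mono g 1 : PsiDO F) = mono 1 1 := by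
    rw [mono_zero_mul_mono, inv_mul_cancel₀ hg]
  rw [darbouxFactor_eq hg, darbouxFactorInv, mul_assoc, ← mul_assoc (mono g⁻¹ 0), e, ← mul_assoc,
    mono_mul_mono_one, neg_add_cancel, mono_zero_mul_mono, mul_inv_cancel₀ hg, one_eq_mono]

theorem isDiff_darbouxFactor (g : F) : (darbouxFactor g).IsDiff :=
  (isDiff_mono _ zero_le_one).sub (isDiff_mono _ le_rfl)

theorem darbouxFactor_apply (g h : F) :
    (darbouxFactor g).apply h = h′ - Differential.logDeriv g * h := by
  rw [darbouxFactor, sub_apply, mono_one_apply, mono_zero_apply, one_mul]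

theorem darbouxFactor_apply_self (g : F) : (darbouxFactor g).apply g = 0 := by
  rw [darbouxFactor_apply, Differential.logDeriv]
  by_cases hg : g = 0
  · simp [hg]
  · rw [div_mul_cancel₀ _ hg, sub_self]

/-- The operator `Q ∘ g` is differential with constant term `Q(g) = 0`, so multiplying by `D⁻¹` on
the right produces no negative power. -/
theorem IsDiff.mul_darbouxFactorInv {Q : PsiDO F} (hQ : Q.IsDiff) {g : F} (hg : Q.apply g = 0) :
    (Q * darbouxFactorInv g).IsDiff := by
  rw [darbouxFactorInv, ← mul_assoc]
  refine IsDiff.mul ?_ (isDiff_mono _ le_rfl)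
  rw [show mono g (-1) = mono g 0 * mono 1 (-1) by rw [mono_mul_mono_one, zero_add], ← mul_assoc]
  intro k hk
  rw [coeff_mul_mono_one]
  rcases (show k - -1 ≤ 0 by omega).lt_or_eq with h | h
  · exact hQ.mul (isDiff_mono g le_rfl) _ h
  · rw [h]; exact hg

/-- The monic differential operator of order `n` that annihilates `f 0, …, f (n - 1)`. -/
noncomputable def dress (f : ℕ → F) : ℕ → PsiDO F
  | 0 => 1
  | n + 1 => darbouxFactor ((dress f n).apply (f n)) * dress f n

/-- The value of the `n`-th dressing operator on `f n`. -/
noncomputable def pivot (f : ℕ → F) (n : ℕ) : F := (dress f n).apply (f n)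

/-- The inverse of the dressing operator. -/
noncomputable def dressInv (f : ℕ → F) : ℕ → PsiDO F
  | 0 => 1
  | n + 1 => dressInv f n * darbouxFactorInv (pivot f n)

variable (f : ℕ → F)

theorem dress_succ (n : ℕ) : dress f (n + 1) = darbouxFactor (pivot f n) * dress f n := rfl

theorem dressInv_succ (n : ℕ) :
    dressInv f (n + 1) = dressInv f n * darbouxFactorInv (pivot f n) := rfl

variable {f}

theorem dress_mul_dressInv {n : ℕ} (h : ∀ i < n, pivot f i ≠ 0) :
    dress f n * dressInv f n = 1 := by
  induction n with
  | zero => exact one_mul _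
  | succ n ih =>
    rw [dress_succ, dressInv_succ, mul_assoc, ← mul_assoc (dress f n),
      ih fun i hi => h i (by omega), one_mul, darbouxFactor_mul_inv (h n (by omega))]

theorem dressInv_mul_dress {n : ℕ} (h : ∀ i < n, pivot f i ≠ 0) :
    dressInv f n * dress f n = 1 := by
  induction n with
  | zero => exact one_mul _
  | succ n ih =>
    rw [dress_succ, dressInv_succ, mul_assoc, ← mul_assoc (darbouxFactorInv _),
      darbouxFactorInv_mul (h n (by omega)), one_mul, ih fun i hi => h i (by omega)]

theorem isDiff_dress (n : ℕ) : (dress f n).IsDiff := by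
  induction n with
  | zero => exact isDiff_one
  | succ n ih => exact (isDiff_darbouxFactor _).mul ih

theorem dress_apply {n i : ℕ} (hi : i < n) : (dress f n).apply (f i) = 0 := by
  induction n with
  | zero => omega
  | succ n ih =>
    rw [dress_succ, apply_mul (isDiff_darbouxFactor _) (isDiff_dress n)]
    rcases (Nat.lt_succ_iff.mp hi).lt_or_eq with h | rfl
    · rw [ih h, apply_zero]
    · exact darbouxFactor_apply_self _

/-- Right division by `dress f n`, one factor at a time: the quotient after `n` factors sends `pivot
f n` to `Q (f n) = 0`, so the next factor divides it as well. -/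
theorem IsDiff.mul_dressInv {Q : PsiDO F} (hQ : Q.IsDiff) {n : ℕ} (h : ∀ i < n, pivot f i ≠ 0)
    (hQf : ∀ i < n, Q.apply (f i) = 0) : (Q * dressInv f n).IsDiff := by
  induction n with
  | zero => rw [show dressInv f 0 = 1 from rfl, mul_one]; exact hQ
  | succ n ih =>
    have h' : ∀ i < n, pivot f i ≠ 0 := fun i hi => h i (by omega)
    have ih := ih h' fun i hi => hQf i (by omega)
    rw [dressInv_succ, ← mul_assoc]
    refine ih.mul_darbouxFactorInv ?_
    rw [pivot, ← apply_mul ih (isDiff_dress n), mul_assoc, dressInv_mul_dress h', mul_one]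
    exact hQf n (by omega)

theorem orderLE_darbouxFactor (g : F) : (darbouxFactor g).OrderLE 1 :=
  (orderLE_mono _ _).sub ((orderLE_mono _ _).mono zero_le_one)

theorem orderLE_dress (n : ℕ) : (dress f n).OrderLE n := by
  induction n with
  | zero => exact orderLE_mono 1 0
  | succ n ih => exact ((orderLE_darbouxFactor _).mul ih).mono (by push_cast; omega)

theorem orderLE_dressInv (n : ℕ) : (dressInv f n).OrderLE (-n) := by
  induction n with
  | zero => exact orderLE_mono 1 0
  | succ n ih =>
    exact (ih.mul ((orderLE_mono _ _).mul (orderLE_mono _ _))).mono (by push_cast; omega)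

theorem coeff_dress_succ (n : ℕ) (k : ℤ) : (dress f (n + 1)).coeff k =
    (dress f n).coeff (k - 1) + ((dress f n).coeff k)′ -
      Differential.logDeriv (pivot f n) * (dress f n).coeff k := by
  rw [dress_succ, darbouxFactor, sub_mul, coeff_sub, coeff_mono_one_mul, coeff_mono_zero_mul,
    one_mul]

theorem coeff_dress_self (n : ℕ) : (dress f n).coeff n = 1 := by
  induction n with
  | zero => simp [show dress f 0 = 1 from rfl, coeff_one]
  | succ n ih =>
    rw [coeff_dress_succ, orderLE_dress n ((n + 1 : ℕ) : ℤ) (by push_cast; omega), map_zero, mul_zero,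
      show ((n + 1 : ℕ) : ℤ) - 1 = n by push_cast; ring, ih, add_zero, sub_zero]

theorem coeff_dress_pred (n : ℕ) : (dress f n).coeff (n - 1) =
    -∑ i ∈ Finset.range n, Differential.logDeriv (pivot f i) := by
  induction n with
  | zero => simpa using isDiff_dress 0 (-1) (by omega)
  | succ n ih =>
    rw [coeff_dress_succ, show ((n + 1 : ℕ) : ℤ) - 1 = n by push_cast; ring, ih, coeff_dress_self,
      Derivation.map_one_eq_zero, Finset.sum_range_succ]
    ring

/-- The determinant of the Wronskian matrix is the product of the pivots. -/
theorem det_wronskian (n : ℕ) :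
    (Matrix.of fun i j : Fin n => (fun f : F => f′)^[(i : ℕ)] (f j)).det =
      ∏ i ∈ Finset.range n, pivot f i := by
  set M : Matrix (Fin n) (Fin n) F := Matrix.of fun i j => (fun f : F => f′)^[(i : ℕ)] (f j)
  -- Row `i` of `A` lists the coefficients of `dress f i`. Thus `A` is lower unitriangular, while `A
  -- * M` is upper triangular with the pivots on the diagonal.
  set A : Matrix (Fin n) (Fin n) F := Matrix.of fun i k => (dress f i).coeff (k : ℕ) with hA
  have hdetA : A.det = 1 := by
    rw [Matrix.det_of_isLowerTriangular A ?_]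
    · exact Finset.prod_eq_one fun i _ => coeff_dress_self _
    · intro i j hij
      exact orderLE_dress _ _ (Int.ofNat_lt.mpr (show (i : ℕ) < j from hij))
  have hAM : A * M = Matrix.of fun i j : Fin n => (dress f i).apply (f j) := by
    ext i j
    have hi : ((i : ℕ) : ℤ) ≤ (n - 1 : ℕ) := by have := i.isLt; omega
    rw [Matrix.mul_apply, Matrix.of_apply, apply_eq_sum (isDiff_dress _)
      ((orderLE_dress _).mono hi), show n - 1 + 1 = n by have := i.isLt; omega, Finset.sum_range]
    rfl
  have hdet : (A * M).det = ∏ i : Fin n, pivot f i := by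
    rw [Matrix.det_of_isUpperTriangular]
    · rw [hAM]; rfl
    · intro i j hij
      rw [hAM]
      exact dress_apply hij
  rw [← Fin.prod_univ_eq_prod_range (pivot f) n, ← hdet, Matrix.det_mul, hdetA, one_mul]

/-! ### Darboux chains that start from `D²` -/

/-- The potential of the operator at the `n`-th step of the Darboux chain. -/
noncomputable def chainPotential (f : ℕ → F) (n : ℕ) : F := -2 * ((dress f n).coeff (n - 1))′

section Chain

variable (hf₀ : (f 0)′′ = 0) (hf : ∀ j, (f (j + 1))′′ = f j)

include hf₀ hf

/-- `D²` maps the span of `f 0, …, f (n-1)` into itself, so `dress f n * D²` kills it and is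
divisible on the right by `dress f n`. The quotient `L` is differential of order at most 2. Its
coefficients follow, from the top down, by comparing those of `D^(n+2)`, `D^(n+1)` and `D^n` in `L *
dress f n = dress f n * D²`. -/
theorem dress_mul_D_sq {n : ℕ} (h : ∀ i < n, pivot f i ≠ 0) :
    dress f n * mono 1 2 = schrodinger (chainPotential f n) * dress f n := by
  set L : PsiDO F := dress f n * mono 1 2 * dressInv f n with hL
  have hLK : L * dress f n = dress f n * mono 1 2 := by
    rw [hL, mul_assoc, dressInv_mul_dress h, mul_one]
  have hLdiff : L.IsDiff := by
    refine ((isDiff_dress n).mul (isDiff_mono _ (by omega))).mul_dressInv h fun i hi => ?_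
    have h2 : (mono 1 2 : PsiDO F).apply (f i) = (f i)′′ := mono_natCast_apply 2 (f i)
    rw [apply_mul (isDiff_dress n) (isDiff_mono _ (by omega)), h2]
    rcases i with _ | i
    · rw [hf₀, apply_zero]
    · rw [hf, dress_apply (by omega)]
  have hLord : L.OrderLE 2 :=
    (((orderLE_dress n).mul (orderLE_mono _ _)).mul (orderLE_dressInv n)).mono (by omega)
  have hexp : L = mono (L.coeff 2) 2 + mono (L.coeff 1) 1 + mono (L.coeff 0) 0 := by
    ext k
    simp only [coeff_add, coeff_mono]
    by_cases h0 : k < 0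
    · simp [hLdiff k h0, show k ≠ 2 by omega, show k ≠ 1 by omega, show k ≠ 0 by omega]
    by_cases h2 : 2 < k
    · simp [hLord k h2, show k ≠ 2 by omega, show k ≠ 1 by omega, show k ≠ 0 by omega]
    obtain rfl | rfl | rfl : k = 0 ∨ k = 1 ∨ k = 2 := by omega
    all_goals simp
  have hcoeff : ∀ k : ℤ, L.coeff 2 * ((dress f n).coeff (k - 2) +
      2 * ((dress f n).coeff (k - 1))′ + ((dress f n).coeff k)′′) +
      L.coeff 1 * ((dress f n).coeff (k - 1) + ((dress f n).coeff k)′) +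
      L.coeff 0 * (dress f n).coeff k = (dress f n).coeff (k - 2) := by
    intro k
    refine Eq.trans ?_ (coeff_mul_mono_one (dress f n) 2 k)
    rw [← hLK]
    conv_rhs => rw [hexp]
    rw [add_mul, add_mul, coeff_add, coeff_add, coeff_mono_two_mul, coeff_mono_one_mul,
      coeff_mono_zero_mul]
  have e2 : L.coeff 2 = 1 := by
    have := hcoeff (n + 2)
    rw [orderLE_dress n ((n : ℤ) + 2) (by omega), orderLE_dress n ((n : ℤ) + 2 - 1) (by omega),
      show (n : ℤ) + 2 - 2 = n by ring, coeff_dress_self] at this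
    simpa using this
  have e1 : L.coeff 1 = 0 := by
    have := hcoeff (n + 1)
    rw [e2, orderLE_dress n ((n : ℤ) + 1) (by omega),
      show (n : ℤ) + 1 - 1 = n by ring, coeff_dress_self] at this
    simpa using this
  have e0 : L.coeff 0 = chainPotential f n := by
    have := hcoeff n
    rw [e2, e1, coeff_dress_self] at this
    simp only [Derivation.map_one_eq_zero, map_zero] at this
    rw [chainPotential]
    linear_combination this
  rw [← hLK, schrodinger_eq]
  conv_lhs => rw [hexp, e2, e1, e0, mono_zero, add_zero]

theorem chain_apply_pivot_zero {n : ℕ} (h : ∀ i < n, pivot f i ≠ 0) :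
    (schrodinger (chainPotential f n)).apply (pivot f n) = 0 := by
  have hS : (schrodinger (chainPotential f n)).IsDiff := by
    rw [schrodinger_eq]; exact (isDiff_mono _ (by omega)).add (isDiff_mono _ le_rfl)
  have h2 : (mono 1 2 : PsiDO F).apply (f n) = (f n)′′ := mono_natCast_apply 2 (f n)
  rw [pivot, ← apply_mul hS (isDiff_dress n), ← dress_mul_D_sq hf₀ hf h,
    apply_mul (isDiff_dress n) (isDiff_mono _ (by omega)), h2]
  rcases n with _ | n
  · rw [hf₀, apply_zero]
  · rw [hf, dress_apply (by omega)]

/-- Put `g = pivot f n` and `s = dress f n (f (n+1))`. With the Schrödinger operator `L` of step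
`n`, `L g = 0` and `L s = g`. The product `g * pivot f (n+1)` is the Wronskian `s' g - s g'`, whose
derivative is `g L s - s L g = g²`. -/
theorem deriv_pivot_mul_pivot {n : ℕ} (h : ∀ i < n + 1, pivot f i ≠ 0) :
    (pivot f n * pivot f (n + 1))′ = pivot f n ^ 2 := by
  have hn : ∀ i < n, pivot f i ≠ 0 := fun i hi => h i (by omega)
  have hS : (schrodinger (chainPotential f n)).IsDiff := by
    rw [schrodinger_eq]; exact (isDiff_mono _ (by omega)).add (isDiff_mono _ le_rfl)
  have h2 : (mono 1 2 : PsiDO F).apply (f (n + 1)) = (f (n + 1))′′ :=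
    mono_natCast_apply 2 (f (n + 1))
  set u := chainPotential f n
  set s := (dress f n).apply (f (n + 1)) with hs
  have hLs : s′′ + u * s = pivot f n := by
    rw [← schrodinger_apply, hs, ← apply_mul hS (isDiff_dress n), ← dress_mul_D_sq hf₀ hf hn,
      apply_mul (isDiff_dress n) (isDiff_mono _ (by omega)), h2, hf, pivot]
  have hLg : (pivot f n)′′ + u * pivot f n = 0 := by
    rw [← schrodinger_apply]; exact chain_apply_pivot_zero hf₀ hf hn
  have hg : pivot f n * pivot f (n + 1) = s′ * pivot f n - s * (pivot f n)′ := by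
    have hne := h n (by omega)
    rw [show pivot f (n + 1) = s′ - Differential.logDeriv (pivot f n) * s by
      rw [pivot, dress_succ, apply_mul (isDiff_darbouxFactor _) (isDiff_dress n),
        darbouxFactor_apply], Differential.logDeriv]
    field_simp
  rw [hg, map_sub, Derivation.leibniz, Derivation.leibniz]
  simp only [smul_eq_mul]
  linear_combination pivot f n * hLs - s * hLg

/-- By the previous identity a vanishing pivot would force the square of its predecessor to vanish.
-/
theorem pivot_ne_zero (hne : f 0 ≠ 0) (n : ℕ) : pivot f n ≠ 0 := by
  induction n using Nat.strong_induction_on with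
  | _ n ih =>
    rcases n with _ | n
    · rwa [pivot, show dress f 0 = 1 from rfl, one_apply]
    · intro h0
      have h := deriv_pivot_mul_pivot hf₀ hf ih
      rw [h0, mul_zero, map_zero] at h
      exact ih n (by omega) (pow_eq_zero_iff two_ne_zero |>.mp h.symm)

/-- The potential at the `n`-th step is `2 (log W)''` for the Wronskian `W`. -/
theorem chainPotential_eq (hne : f 0 ≠ 0) (n : ℕ) : chainPotential f n =
    2 * (Differential.logDeriv (∏ i ∈ Finset.range n, pivot f i))′ := by
  rw [Differential.logDeriv_prod _ _ _ fun i _ => pivot_ne_zero hf₀ hf hne i, chainPotential,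
    coeff_dress_pred, map_neg]
  ring

/-- The dressed operator `D`. -/
theorem isSqrt_dress (hne : f 0 ≠ 0) (n : ℕ) :
    (dress f n * mono 1 1 * dressInv f n).IsSqrt (schrodinger (chainPotential f n)) := by
  have hg : ∀ i < n, pivot f i ≠ 0 := fun i _ => pivot_ne_zero hf₀ hf hne i
  have hD : (dress f n * mono 1 1).OrderLE (n + 1) := (orderLE_dress n).mul (orderLE_mono _ _)
  refine ⟨?_, ?_, ?_⟩
  -- Leading coefficients in `dress * dressInv = 1` show that the inverse is monic too.
  · have hinv : (dressInv f n).coeff (-n) = 1 := by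
      have h1 := (orderLE_dress (f := f) n).coeff_mul (orderLE_dressInv (f := f) n)
      rw [dress_mul_dressInv hg, coeff_dress_self, one_mul, add_neg_cancel] at h1
      exact h1.symm
    have h2 := hD.coeff_mul (orderLE_dressInv (f := f) n)
    rw [coeff_mul_mono_one, hinv, mul_one, show (n : ℤ) + 1 + -n = 1 by ring,
      show (n : ℤ) + 1 - 1 = n by ring, coeff_dress_self] at h2
    exact h2
  · exact (hD.mul (orderLE_dressInv n)).mono (by omega)
  · rw [show dress f n * mono 1 1 * dressInv f n * (dress f n * mono 1 1 * dressInv f n) =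
      dress f n * mono 1 1 * (dressInv f n * dress f n) * mono 1 1 * dressInv f n by noncomm_ring,
      dressInv_mul_dress hg, mul_one, mul_assoc (dress f n), mono_mul_mono_one]
    change dress f n * mono 1 2 * _ = _
    rw [dress_mul_D_sq hf₀ hf hg, mul_assoc, dress_mul_dressInv hg, mul_one]

theorem dress_mul_D_mul_dressInv_pow (hne : f 0 ≠ 0) (n m : ℕ) :
    (dress f n * mono 1 1 * dressInv f n) ^ m = dress f n * mono 1 m * dressInv f n := by
  have hg : ∀ i < n, pivot f i ≠ 0 := fun i _ => pivot_ne_zero hf₀ hf hne i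
  induction m with
  | zero =>
    rw [pow_zero, Nat.cast_zero, ← one_eq_mono, mul_one, dress_mul_dressInv hg]
  | succ m ih =>
    rw [pow_succ, ih, show dress f n * mono 1 m * dressInv f n *
      (dress f n * mono 1 1 * dressInv f n) =
      dress f n * mono 1 m * (dressInv f n * dress f n) * mono 1 1 * dressInv f n by noncomm_ring,
      dressInv_mul_dress hg, mul_one, mul_assoc (dress f n), mono_mul_mono_one, Nat.cast_succ]

/-- The Lax equation for flows under which each `f j` evolves by `∂_t f j = D^m f j`, up to
combinations of `f 0, …, f j` with coefficients that do not depend on `x`. -/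
theorem lax_equation (hne : f 0 ≠ 0) {d : Derivation ℤ F F} (hd : ∀ g : F, d g′ = (d g)′) (m : ℕ)
    (c : ℕ → ℕ → F) (hc : ∀ j i, (c j i)′ = 0)
    (hflow : ∀ j, d (f j) = (fun g : F => g′)^[m] (f j) +
      ∑ i ∈ Finset.range (j + 1), c j i * f i) (n : ℕ) :
    (schrodinger (chainPotential f n)).coeffDeriv d =
      commutator ((dress f n * mono 1 1 * dressInv f n) ^ m).plus
        (schrodinger (chainPotential f n)) := by
  have hg : ∀ i < n, pivot f i ≠ 0 := fun i _ => pivot_ne_zero hf₀ hf hne i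
  set A := dress f n
  set A' := dressInv f n
  set L := schrodinger (chainPotential f n)
  have hAd : A.IsDiff := isDiff_dress n
  have hDm : (mono 1 m : PsiDO F).IsDiff := isDiff_mono _ (by omega)
  set B := A.coeffDeriv d + A * mono 1 m with hB
  have hBd : B.IsDiff := (hAd.coeffDeriv d).add (hAd.mul hDm)
  -- Apply `d` to `A (f i) = 0`. The correction terms of the flow are constant combinations of `f 0,
  -- …, f i`, which `A` kills.
  have hBf : ∀ i < n, B.apply (f i) = 0 := by
    intro i hi
    have h1 := deriv_apply hd A (f i)
    rw [dress_apply hi, map_zero, hflow, apply_add, apply_sum] at h1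
    rw [Finset.sum_eq_zero, add_zero] at h1
    · rw [hB, add_apply, apply_mul hAd hDm, mono_natCast_apply]
      exact h1.symm
    · intro j hj
      rw [Finset.mem_range] at hj
      rw [apply_mul_of_deriv_eq_zero _ (hc i j), dress_apply (by omega), mul_zero]
  set Q := B * A' with hQ
  have hQd : Q.IsDiff := hBd.mul_dressInv hg hBf
  have hQA : Q * A = B := by rw [hQ, mul_assoc, dressInv_mul_dress hg, mul_one]
  have hplus : ((A * mono 1 1 * A') ^ m).plus = Q := by
    rw [dress_mul_D_mul_dressInv_pow hf₀ hf hne, show A * mono 1 m * A' = Q - A.coeffDeriv d * A' by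
      rw [hQ, hB, add_mul]; abel]
    -- As `A` is monic of order `n`, differentiating its coefficients lowers the order. So in `A D^m
    -- A⁻¹ = Q - (∂A) A⁻¹` the last term is purely of negative order.
    have hneg : (A.coeffDeriv d * A').OrderLE (-1) := by
      refine OrderLE.mono (M := (n - 1 : ℤ) + -n) (OrderLE.mul ?_ (orderLE_dressInv n)) (by omega)
      intro k hk
      rcases (show (n : ℤ) ≤ k by omega).lt_or_eq with h | rfl
      · rw [coeff_coeffDeriv, orderLE_dress n k h, map_zero]
      · rw [coeff_coeffDeriv, coeff_dress_self, Derivation.map_one_eq_zero]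
    ext k
    change (if 0 ≤ k then (Q - A.coeffDeriv d * A').coeff k else 0) = Q.coeff k
    split_ifs with hk
    · rw [coeff_sub, hneg k (by omega), sub_zero]
    · rw [hQd k (by omega)]
  rw [hplus]
  have hLA : A * mono 1 2 = L * A := dress_mul_D_sq hf₀ hf hg
  -- The derivative of `A D² = L A`. Substituting `∂A = Q A - A D^m` turns it into `(∂L) A = [Q, L]
  -- A`, and `A` can be cancelled.
  have hdL : A.coeffDeriv d * mono 1 2 = L.coeffDeriv d * A + L * A.coeffDeriv d := by
    rw [← coeffDeriv_mul hd, ← hLA, coeffDeriv_mul hd, coeffDeriv_mono,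
      Derivation.map_one_eq_zero, mono_zero, mul_zero, add_zero]
  have hAt : A.coeffDeriv d = Q * A - A * mono 1 m := by rw [hQA, hB]; abel
  have hcomm : (mono 1 m * mono 1 2 : PsiDO F) = mono 1 2 * mono 1 m := by
    rw [mono_mul_mono_one, mono_mul_mono_one, add_comm]
  have hfin : L.coeffDeriv d * A = (Q * L - L * Q) * A := by
    rw [eq_sub_of_add_eq hdL.symm, hAt, sub_mul, mul_assoc Q, hLA, mul_assoc A, hcomm, ← mul_assoc A,
      hLA]
    noncomm_ring
  calc L.coeffDeriv d = L.coeffDeriv d * A * A' := by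
        rw [mul_assoc, dress_mul_dressInv hg, mul_one]
    _ = Q * L - L * Q := by rw [hfin, mul_assoc, dress_mul_dressInv hg, mul_one]

end Chain

end PsiDO

/-! ### Coefficientwise derivations of power series -/

namespace PowerSeries

section SeriesDeriv

variable {R A : Type*} [CommRing R] [CommRing A] [Algebra R A]

/-- A derivation of the ring of coefficients, applied to each coefficient of a power series. -/
noncomputable def seriesDeriv (d : Derivation R A A) : Derivation R A⟦X⟧ A⟦X⟧ :=
  Derivation.mk'
    { toFun := fun p => PowerSeries.mk fun n => d (coeff n p)
      map_add' := fun p q => by ext n; simp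
      map_smul' := fun r p => by ext n; simp }
    (by
      intro p q
      ext n
      simp only [LinearMap.coe_mk, AddHom.coe_mk, coeff_mk, smul_eq_mul, map_add, coeff_mul,
        map_sum, Derivation.leibniz, Finset.sum_add_distrib]
      congr 1
      exact Finset.Nat.sum_antidiagonal_swap (f := fun x => coeff x.1 q * d (coeff x.2 p)))

@[simp] theorem coeff_seriesDeriv (d : Derivation R A A) (p : A⟦X⟧) (n : ℕ) :
    coeff n (seriesDeriv d p) = d (coeff n p) := by
  change coeff n (PowerSeries.mk fun n => d (coeff n p)) = _
  rw [coeff_mk]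

theorem coeff_iterate_seriesDeriv (d : Derivation R A A) (m : ℕ) (p : A⟦X⟧) (n : ℕ) :
    coeff n ((seriesDeriv d)^[m] p) = d^[m] (coeff n p) := by
  induction m generalizing p with
  | zero => rfl
  | succ m ih => rw [Function.iterate_succ_apply, ih, coeff_seriesDeriv,
      Function.iterate_succ_apply]

theorem seriesDeriv_X_pow_mul (d : Derivation R A A) (m : ℕ) (p : A⟦X⟧) :
    seriesDeriv d (X ^ m * p) = X ^ m * seriesDeriv d p := by
  ext n
  rw [coeff_seriesDeriv, coeff_X_pow_mul', coeff_X_pow_mul', coeff_seriesDeriv, apply_ite d,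
    map_zero]

end SeriesDeriv

/-- The chain rule for a coefficientwise derivation. -/
theorem seriesDeriv_subst {A : Type*} [CommRing A] [Algebra ℚ A] (d : Derivation ℚ A A)
    (p : ℚ⟦X⟧) {T : A⟦X⟧} (hT : HasSubst T) :
    seriesDeriv d (p.subst T) = (derivative ℚ p).subst T * seriesDeriv d T := by
  have hpoly (p : Polynomial ℚ) : seriesDeriv d ((p : ℚ⟦X⟧).subst T) =
      (derivative ℚ (p : ℚ⟦X⟧)).subst T * seriesDeriv d T := by
    rw [subst_coe hT, derivative_coe, subst_coe hT, Derivation.comp_aeval_eq, smul_eq_mul]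
  ext n
  -- The powers `T^e` with `e ≥ m` have no coefficients up to `n`, so `p` may be replaced by a
  -- polynomial. The truncation keeps degree `m` because the derivative lowers degrees by one.
  obtain ⟨m, hm⟩ := (hT.eventually_coeff_pow_eq_zero n).exists_forall_of_atTop
  have : coeff n (p.subst T) = coeff n ((↑(trunc (m + 1) p) : ℚ⟦X⟧).subst T) := by
    rw [coeff_subst' hT, coeff_subst' hT]
    refine finsum_congr fun e => ?_
    obtain he | he := lt_or_ge e m
    · rw [coeff_coe_trunc_of_lt (by lia)]
    · simp [coeff_trunc, he, hm]
  rw [coeff_seriesDeriv, this, ← coeff_seriesDeriv, hpoly, coeff_mul, coeff_mul]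
  refine Finset.sum_congr rfl fun ⟨i, j⟩ hij => ?_
  congr 1
  simp only [coeff_subst' hT, coeff_derivative, Polynomial.coeff_coe, coeff_trunc]
  exact finsum_congr fun e => by
    split_ifs <;> simp (disch := grind [Finset.HasAntidiagonal.mem_antidiagonal]) [hm]

theorem rescale_neg_one_eq_neg_iff {A : Type*} [CommRing A] [NoZeroDivisors A] [CharZero A]
    {p : A⟦X⟧} : rescale (-1) p = -p ↔ ∀ n, Even n → coeff n p = 0 := by
  constructor
  · intro h n hn
    have h1 := congrArg (coeff n) h
    rw [coeff_rescale, hn.neg_one_pow, one_mul, map_neg, eq_neg_iff_add_eq_zero, ← two_mul] at h1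
    exact (mul_eq_zero.mp h1).resolve_left two_ne_zero
  · intro h
    ext n
    rw [coeff_rescale, map_neg]
    rcases Nat.even_or_odd n with hn | hn
    · rw [h n hn, mul_zero, neg_zero]
    · rw [hn.neg_one_pow, neg_one_mul]

end PowerSeries

namespace AdlerMoser

open PowerSeries

/-! ### Hyperbolic functions -/

theorem derivative_sinhSeries : derivative ℚ (sinhSeries ℚ) = coshSeries ℚ := by
  ext n
  rw [coeff_derivative, sinhSeries, coshSeries, coeff_mk, coeff_mk]
  simp only [Nat.odd_add_one, Nat.not_odd_iff_even]
  split_ifs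
  · rw [Nat.factorial_succ]
    push_cast
    field_simp
  · rw [zero_mul]

theorem derivative_coshSeries : derivative ℚ (coshSeries ℚ) = sinhSeries ℚ := by
  ext n
  rw [coeff_derivative, sinhSeries, coshSeries, coeff_mk, coeff_mk]
  simp only [Nat.even_add_one, Nat.not_even_iff_odd]
  split_ifs
  · rw [Nat.factorial_succ]
    push_cast
    field_simp
  · rw [zero_mul]

theorem constantCoeff_coshSeries : constantCoeff (coshSeries ℚ) = 1 := by
  rw [← coeff_zero_eq_constantCoeff_apply, coshSeries, coeff_mk]
  simp

theorem constantCoeff_sinhSeries : constantCoeff (sinhSeries ℚ) = 0 := by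
  rw [← coeff_zero_eq_constantCoeff_apply, sinhSeries, coeff_mk]
  simp

theorem coshSeries_mul_inv : coshSeries ℚ * (coshSeries ℚ)⁻¹ = 1 :=
  PowerSeries.mul_inv_cancel _ (by rw [constantCoeff_coshSeries]; exact one_ne_zero)

theorem derivative_tanhSeries : derivative ℚ tanhSeries = 1 - tanhSeries ^ 2 := by
  rw [tanhSeries, Derivation.leibniz, derivative_inv', derivative_sinhSeries,
    derivative_coshSeries, smul_eq_mul, smul_eq_mul]
  linear_combination coshSeries_mul_inv

theorem rescale_tanhSeries : rescale (-1) tanhSeries = -tanhSeries := by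
  have hs : rescale (-1) (sinhSeries ℚ) = -sinhSeries ℚ := by
    rw [rescale_neg_one_eq_neg_iff]
    intro n hn
    rw [sinhSeries, coeff_mk, if_neg (Nat.not_odd_iff_even.mpr hn)]
  have hc : rescale (-1) (coshSeries ℚ) = coshSeries ℚ := by
    ext n
    rw [coeff_rescale, coshSeries, coeff_mk]
    split_ifs with hn
    · rw [hn.neg_one_pow, one_mul]
    · rw [mul_zero]
  have ht : tanhSeries * coshSeries ℚ = sinhSeries ℚ := by
    rw [tanhSeries]
    linear_combination sinhSeries ℚ * coshSeries_mul_inv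
  have h := congrArg (rescale (-1)) ht
  rw [map_mul, hc, hs] at h
  linear_combination (coshSeries ℚ)⁻¹ * (h + ht) -
    (rescale (-1) tanhSeries + tanhSeries) * coshSeries_mul_inv

theorem coeff_one_tanhSeries : coeff 1 tanhSeries = 1 := by
  have h := congrArg constantCoeff derivative_tanhSeries
  have h0 : constantCoeff tanhSeries = 0 := by
    rw [tanhSeries, map_mul, constantCoeff_sinhSeries, zero_mul]
  rw [← coeff_zero_eq_constantCoeff_apply, coeff_derivative, map_sub, map_pow, h0] at h
  simpa using h

theorem coeff_tanhSeries_of_even {n : ℕ} (hn : Even n) : coeff n tanhSeries = 0 :=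
  rescale_neg_one_eq_neg_iff.mp rescale_tanhSeries n hn

/-! ### Power series over polynomials: `tanh` of the times and the hyperbolic functions of `x z` -/

section Polynomials

variable (K : Type*) [Field K]

/-- `∑_{i ≥ 2} t_{2i-1} z^{2i-1}`. -/
noncomputable def timeSeries : PowerSeries (MvPolynomial ℕ K) :=
  oddSeries (MvPolynomial.X : ℕ → MvPolynomial ℕ K)

theorem coeff_oddSeries {A : Type*} [CommRing A] (c : ℕ → A) (n : ℕ) :
    coeff n (oddSeries c) = if Odd n ∧ 3 ≤ n then c (n / 2) else 0 := coeff_mk _ _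

theorem hasSubst_timeSeries : HasSubst (timeSeries K) := by
  refine HasSubst.of_constantCoeff_zero' ?_
  rw [← coeff_zero_eq_constantCoeff_apply, timeSeries, coeff_oddSeries, if_neg (by simp)]

/-- If one factor contributes `t_{2i+1} z^(2i+1)`, the other `d - 1` factors contribute at least `z`
each, so `2 i + d ≤ m`. They even contribute `z³`, but this bound suffices for triangularity. -/
theorem coeff_timeSeries_pow_mem (d m : ℕ) :
    coeff m (timeSeries K ^ d) ∈ MvPolynomial.supported K {i | 2 * i + d ≤ m} := by
  induction d generalizing m with
  | zero =>
    rw [pow_zero, coeff_one]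
    split_ifs
    · exact one_mem _
    · exact zero_mem _
  | succ d ih =>
    rw [pow_succ, coeff_mul]
    refine sum_mem fun p hp => ?_
    rw [Finset.HasAntidiagonal.mem_antidiagonal] at hp
    have hd : p.1 < d → coeff p.1 (timeSeries K ^ d) = 0 := fun h => by
      obtain ⟨V, hV⟩ : (X : PowerSeries (MvPolynomial ℕ K)) ∣ timeSeries K := by
        rw [X_dvd_iff, ← coeff_zero_eq_constantCoeff_apply, timeSeries, coeff_oddSeries,
          if_neg (by simp)]
      rw [hV, mul_pow, coeff_X_pow_mul', if_neg (by omega)]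
    by_cases h1 : p.1 < d
    · rw [hd h1, zero_mul]; exact zero_mem _
    rw [timeSeries, coeff_oddSeries]
    split_ifs with h2
    · refine mul_mem (MvPolynomial.supported_mono ?_ (ih p.1)) ?_
      · intro i (hi : 2 * i + d ≤ p.1)
        change 2 * i + (d + 1) ≤ m
        omega
      · rw [MvPolynomial.X_mem_supported]
        change 2 * (p.2 / 2) + (d + 1) ≤ m
        obtain ⟨j, hj⟩ := h2.1
        omega
    · rw [mul_zero]; exact zero_mem _

theorem coeff_timeSeries_pow_of_lt {d m : ℕ} (hd : d ≠ 0) (hm : m < 3) :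
    coeff m (timeSeries K ^ d) = 0 := by
  obtain ⟨d, rfl⟩ := Nat.exists_eq_succ_of_ne_zero hd
  rw [pow_succ, coeff_mul]
  refine Finset.sum_eq_zero fun p hp => ?_
  rw [Finset.HasAntidiagonal.mem_antidiagonal] at hp
  rw [timeSeries, coeff_oddSeries, if_neg (by omega), mul_zero]

variable [CharZero K]

theorem coeff_tanhTimes (n : ℕ) : coeff n (tanhTimes K) =
    ∑ᶠ d : ℕ, coeff d tanhSeries • coeff n (timeSeries K ^ d) :=
  coeff_subst' (hasSubst_timeSeries K) tanhSeries n

theorem coeff_tanhTimes_of_even {n : ℕ} (hn : Even n) : coeff n (tanhTimes K) = 0 := by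
  rw [coeff_tanhTimes]
  refine finsum_eq_zero_of_forall_eq_zero fun d => ?_
  rcases Nat.even_or_odd d with hd | hd
  · rw [coeff_tanhSeries_of_even hd, zero_smul]
  · have hT : rescale (-1) (timeSeries K) = -timeSeries K := by
      rw [rescale_neg_one_eq_neg_iff]
      intro m hm
      rw [timeSeries, coeff_oddSeries, if_neg fun h => Nat.not_odd_iff_even.mpr hm h.1]
    have hTd : rescale (-1) (timeSeries K ^ d) = -timeSeries K ^ d := by
      rw [map_pow, hT, hd.neg_pow]
    rw [rescale_neg_one_eq_neg_iff.mp hTd n hn, smul_zero]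

theorem coeff_tanhTimes_of_lt {n : ℕ} (hn : n < 3) : coeff n (tanhTimes K) = 0 := by
  rw [coeff_tanhTimes]
  refine finsum_eq_zero_of_forall_eq_zero fun d => ?_
  rcases eq_or_ne d 0 with rfl | hd
  · rw [coeff_tanhSeries_of_even (by simp), zero_smul]
  · rw [coeff_timeSeries_pow_of_lt K hd hn, smul_zero]

/-- The linear term of `tanh` contributes exactly `X k`, there is no constant term, and the powers
`d ≥ 2` involve only variables of index below `k`. -/
theorem coeff_tanhTimes_sub_mem {k : ℕ} (hk : 1 ≤ k) :
    coeff (2 * k + 1) (tanhTimes K) - MvPolynomial.X k ∈ MvPolynomial.supported K (Set.Iio k) := by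
  have hfin := coeff_subst_finite' (hasSubst_timeSeries K) tanhSeries (2 * k + 1)
  have h1 : coeff 1 tanhSeries • coeff (2 * k + 1) (timeSeries K ^ 1) = MvPolynomial.X k := by
    rw [coeff_one_tanhSeries, one_smul, pow_one, timeSeries, coeff_oddSeries,
      if_pos ⟨⟨k, rfl⟩, by omega⟩]
    congr 1
    omega
  rw [coeff_tanhTimes, finsum_eq_sum_of_support_subset _ (s := insert 1 hfin.toFinset) (by
    intro d hd
    exact Finset.mem_insert_of_mem (Set.Finite.mem_toFinset hfin |>.mpr hd)), ← Finset.add_sum_erase _ _ (Finset.mem_insert_self _ _), h1,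
    add_sub_cancel_left]
  refine sum_mem fun d hd => ?_
  have hd1 := Finset.ne_of_mem_erase hd
  rcases eq_or_ne d 0 with rfl | hd0
  · rw [coeff_tanhSeries_of_even (by simp), zero_smul]; exact zero_mem _
  · have hmem := coeff_timeSeries_pow_mem K d (2 * k + 1)
    rw [← algebraMap_smul K]
    refine Subalgebra.smul_mem _ (MvPolynomial.supported_mono ?_ hmem) _
    intro i (hi : 2 * i + d ≤ 2 * k + 1)
    change i < k
    omega

/-- The derivation `∂/∂t_{2k+1}` of power series with polynomial coefficients. -/
noncomputable def dSeries (k : ℕ) :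
    Derivation ℚ (PowerSeries (MvPolynomial ℕ K)) (PowerSeries (MvPolynomial ℕ K)) :=
  seriesDeriv ((MvPolynomial.pderiv (R := K) k).restrictScalars ℚ)

@[simp] theorem coeff_dSeries (k : ℕ) (p : PowerSeries (MvPolynomial ℕ K)) (n : ℕ) :
    coeff n (dSeries K k p) = MvPolynomial.pderiv k (coeff n p) := coeff_seriesDeriv _ _ _

theorem coeff_iterate_dSeries (k m : ℕ) (p : PowerSeries (MvPolynomial ℕ K)) (n : ℕ) :
    coeff n ((dSeries K k)^[m] p) =
      (fun g : MvPolynomial ℕ K => MvPolynomial.pderiv k g)^[m] (coeff n p) :=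
  coeff_iterate_seriesDeriv _ _ _ _

theorem dSeries_X_pow_mul (k m : ℕ) (p : PowerSeries (MvPolynomial ℕ K)) :
    dSeries K k (X ^ m * p) = X ^ m * dSeries K k p := seriesDeriv_X_pow_mul _ _ _

theorem dSeries_zero_oddSeries {c : ℕ → MvPolynomial ℕ K}
    (hc : ∀ i, 1 ≤ i → MvPolynomial.pderiv 0 (c i) = 0) : dSeries K 0 (oddSeries c) = 0 := by
  ext1 n
  rw [coeff_dSeries, coeff_oddSeries, map_zero]
  split_ifs with h
  · exact hc _ (by omega)
  · exact map_zero _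

theorem dSeries_timeSeries {k : ℕ} (hk : 1 ≤ k) :
    dSeries K k (timeSeries K) = X ^ (2 * k + 1) := by
  ext1 n
  rw [coeff_dSeries, timeSeries, coeff_oddSeries, coeff_X_pow]
  split_ifs with h1 h2 h2
  · rw [h2, show (2 * k + 1) / 2 = k by omega, MvPolynomial.pderiv_X_self]
  · obtain ⟨j, hj⟩ := h1.1
    exact MvPolynomial.pderiv_X_of_ne (by omega)
  · exact absurd ⟨⟨k, h2⟩, by omega⟩ h1
  · exact map_zero _

theorem dSeries_tanhTimes {k : ℕ} (hk : 1 ≤ k) :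
    dSeries K k (tanhTimes K) = X ^ (2 * k + 1) * (1 - tanhTimes K ^ 2) := by
  have h := seriesDeriv_subst ((MvPolynomial.pderiv (R := K) k).restrictScalars ℚ) tanhSeries
    (hasSubst_timeSeries K)
  rw [derivative_tanhSeries] at h
  have h2 : (1 - tanhSeries ^ 2 : ℚ⟦X⟧).subst (timeSeries K) = 1 - tanhTimes K ^ 2 := by
    rw [← coe_substAlgHom (hasSubst_timeSeries K), map_sub, map_one, map_pow,
      coe_substAlgHom]
    rfl
  rw [h2] at h
  rw [mul_comm, ← dSeries_timeSeries K hk]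
  exact h

theorem dSeries_zero_tanhTimes : dSeries K 0 (tanhTimes K) = 0 := by
  have h := seriesDeriv_subst ((MvPolynomial.pderiv (R := K) 0).restrictScalars ℚ) tanhSeries
    (hasSubst_timeSeries K)
  refine h.trans ?_
  change _ * dSeries K 0 (timeSeries K) = 0
  rw [timeSeries, dSeries_zero_oddSeries K fun i hi => MvPolynomial.pderiv_X_of_ne (by omega),
    mul_zero]

/-- `sinh (x z)`. -/
noncomputable def sinhX : PowerSeries (MvPolynomial ℕ K) :=
  rescale (MvPolynomial.X 0) (sinhSeries (MvPolynomial ℕ K))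

/-- `cosh (x z)`. -/
noncomputable def coshX : PowerSeries (MvPolynomial ℕ K) :=
  rescale (MvPolynomial.X 0) (coshSeries (MvPolynomial ℕ K))

theorem coeff_sinhX (n : ℕ) : coeff n (sinhX K) =
    if Odd n then MvPolynomial.X 0 ^ n * MvPolynomial.C ((n.factorial : K)⁻¹) else 0 := by
  rw [sinhX, coeff_rescale, sinhSeries, coeff_mk, mul_ite, mul_zero,
    IsScalarTower.algebraMap_apply ℚ K, MvPolynomial.algebraMap_eq]
  simp

theorem coeff_coshX (n : ℕ) : coeff n (coshX K) =
    if Even n then MvPolynomial.X 0 ^ n * MvPolynomial.C ((n.factorial : K)⁻¹) else 0 := by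
  rw [coshX, coeff_rescale, coshSeries, coeff_mk, mul_ite, mul_zero,
    IsScalarTower.algebraMap_apply ℚ K, MvPolynomial.algebraMap_eq]
  simp

theorem pderiv_X_pow_mul_factorial (n : ℕ) :
    MvPolynomial.pderiv (R := K) 0
        (MvPolynomial.X 0 ^ (n + 1) * MvPolynomial.C (((n + 1).factorial : K)⁻¹)) =
      MvPolynomial.X 0 ^ n * MvPolynomial.C ((n.factorial : K)⁻¹) := by
  have h : ((n + 1 : ℕ) : K) * ((n + 1).factorial : K)⁻¹ = (n.factorial : K)⁻¹ := by
    rw [Nat.factorial_succ]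
    push_cast
    field_simp
  rw [mul_comm, MvPolynomial.pderiv_C_mul, MvPolynomial.pderiv_pow, MvPolynomial.pderiv_X_self,
    ← h, map_mul, map_natCast, Nat.add_sub_cancel]
  ring

theorem dSeries_zero_sinhX : dSeries K 0 (sinhX K) = X * coshX K := by
  ext1 n
  rw [coeff_dSeries]
  rcases n with _ | n
  · rw [coeff_zero_X_mul, coeff_sinhX, if_neg (by simp), map_zero]
  · rw [coeff_succ_X_mul, coeff_sinhX, coeff_coshX]
    simp only [Nat.odd_add_one, Nat.not_odd_iff_even]
    split_ifs
    · exact pderiv_X_pow_mul_factorial K n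
    · exact map_zero _

theorem dSeries_zero_coshX : dSeries K 0 (coshX K) = X * sinhX K := by
  ext1 n
  rw [coeff_dSeries]
  rcases n with _ | n
  · rw [coeff_zero_X_mul, coeff_coshX, if_pos (by simp)]
    simp
  · rw [coeff_succ_X_mul, coeff_sinhX, coeff_coshX]
    simp only [Nat.even_add_one, Nat.not_even_iff_odd]
    split_ifs
    · exact pderiv_X_pow_mul_factorial K n
    · exact map_zero _

theorem dSeries_succ_sinhX {k : ℕ} (hk : 1 ≤ k) : dSeries K k (sinhX K) = 0 := by
  ext1 n
  rw [coeff_dSeries, coeff_sinhX, map_zero]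
  split_ifs
  · rw [mul_comm, MvPolynomial.pderiv_C_mul, MvPolynomial.pderiv_pow,
      MvPolynomial.pderiv_X_of_ne (by omega), mul_zero, mul_zero]
  · exact map_zero _

theorem dSeries_succ_coshX {k : ℕ} (hk : 1 ≤ k) : dSeries K k (coshX K) = 0 := by
  ext1 n
  rw [coeff_dSeries, coeff_coshX, map_zero]
  split_ifs
  · rw [mul_comm, MvPolynomial.pderiv_C_mul, MvPolynomial.pderiv_pow,
      MvPolynomial.pderiv_X_of_ne (by omega), mul_zero, mul_zero]
  · exact map_zero _

/-- `sinh (x z) + cosh (x z) Θ`. -/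
noncomputable def waveSeries (Θ : PowerSeries (MvPolynomial ℕ K)) :
    PowerSeries (MvPolynomial ℕ K) := sinhX K + coshX K * Θ

/-! ### The wave series and its evolution in `x` and in the times -/

variable {K} {Θ : PowerSeries (MvPolynomial ℕ K)}

theorem dSeries_zero_waveSeries (hΘ : dSeries K 0 Θ = 0) :
    dSeries K 0 (waveSeries K Θ) = X * (coshX K + sinhX K * Θ) := by
  rw [waveSeries, map_add, Derivation.leibniz, hΘ, dSeries_zero_sinhX, dSeries_zero_coshX]
  simp only [smul_eq_mul]
  ring

theorem dSeries_zero_zero_waveSeries (hΘ : dSeries K 0 Θ = 0) :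
    dSeries K 0 (dSeries K 0 (waveSeries K Θ)) = X ^ 2 * waveSeries K Θ := by
  rw [dSeries_zero_waveSeries hΘ, ← pow_one X, dSeries_X_pow_mul, map_add, Derivation.leibniz, hΘ,
    dSeries_zero_sinhX, dSeries_zero_coshX, waveSeries]
  simp only [smul_eq_mul]
  ring

theorem iterate_dSeries_waveSeries (hΘ : dSeries K 0 Θ = 0) (j : ℕ) :
    (dSeries K 0)^[2 * j + 1] (waveSeries K Θ) =
      X ^ (2 * j + 1) * (coshX K + sinhX K * Θ) := by
  have h : ∀ j : ℕ, (dSeries K 0)^[2 * j] (waveSeries K Θ) = X ^ (2 * j) * waveSeries K Θ := by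
    intro j
    induction j with
    | zero => simp
    | succ j ih =>
      rw [show 2 * (j + 1) = 2 * j + 1 + 1 by ring, Function.iterate_succ_apply',
        Function.iterate_succ_apply', ih, dSeries_X_pow_mul, dSeries_X_pow_mul,
        dSeries_zero_zero_waveSeries hΘ]
      ring
  rw [Function.iterate_succ_apply', h, dSeries_X_pow_mul, dSeries_zero_waveSeries hΘ]
  ring

/-- The wave series is `sinh (x z + T) / cosh T`. Its numerator evolves by `D^(2k+1)`, and the
denominator contributes the factor `-z^(2k+1) tanh T`, free of `x`. The computation uses `tanh' = 1
- tanh²` and `cosh (1 - Θ²) = (cosh + sinh Θ) - Θ (sinh + cosh Θ)`. -/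
theorem dSeries_waveSeries_tanhTimes {k : ℕ} (hk : 1 ≤ k) :
    dSeries K k (waveSeries K (tanhTimes K)) =
      (dSeries K 0)^[2 * k + 1] (waveSeries K (tanhTimes K)) -
        X ^ (2 * k + 1) * tanhTimes K * waveSeries K (tanhTimes K) := by
  rw [iterate_dSeries_waveSeries (dSeries_zero_tanhTimes K)]
  rw [waveSeries, map_add, Derivation.leibniz, dSeries_tanhTimes K hk, dSeries_succ_sinhX K hk,
    dSeries_succ_coshX K hk]
  simp only [smul_eq_mul]
  ring

theorem coeff_waveSeries_of_even (hΘ : ∀ n, Even n → coeff n Θ = 0) {n : ℕ} (hn : Even n) :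
    coeff n (waveSeries K Θ) = 0 := by
  rw [waveSeries, map_add, coeff_sinhX, if_neg (Nat.not_odd_iff_even.mpr hn), zero_add, coeff_mul]
  refine Finset.sum_eq_zero fun p hp => ?_
  rw [Finset.HasAntidiagonal.mem_antidiagonal] at hp
  rw [← hp, Nat.even_add] at hn
  by_cases h : Even p.1
  · rw [hΘ _ (hn.mp h), mul_zero]
  · rw [coeff_coshX, if_neg h, zero_mul]

end Polynomials

end AdlerMoser

/-! ### Derivations of the field of fractions -/

namespace Derivation

theorem eq_zero_of_algebraMap {R F : Type*} [CommRing R] [Field F] [Algebra R F]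
    [IsFractionRing R F] (D : Derivation ℤ F F) (h : ∀ a : R, D (algebraMap R F a) = 0)
    (f : F) : D f = 0 := by
  obtain ⟨a, b, _, rfl⟩ := IsFractionRing.div_surjective (A := R) f
  rw [leibniz_div, h, h, smul_zero, smul_zero, sub_zero, smul_zero]

variable {k R F : Type*} [CommRing k] [CommRing R] [IsDomain R] [Algebra k R]
  [Field F] [Algebra R F] [IsFractionRing R F]

theorem frac_algebraMap (d : Derivation k R R) (a : R) :
    d.frac F (algebraMap R F a) = algebraMap R F (d a) := by
  have h := d.fracFun_div F a 1 one_ne_zero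
  rw [map_one, div_one, map_one_eq_zero, mul_zero, sub_zero, mul_one, one_pow, div_one] at h
  exact h

/-- The commutator of the extensions is a derivation of `F` that vanishes on `R`, hence everywhere.
-/
theorem frac_comm (d e : Derivation k R R) (hde : ∀ a, d (e a) = e (d a)) (f : F) :
    d.frac F (e.frac F f) = e.frac F (d.frac F f) := by
  have h := eq_zero_of_algebraMap (R := R) ⁅d.frac F, e.frac F⁆ (fun a => by
    rw [commutator_apply, frac_algebraMap, frac_algebraMap, frac_algebraMap, frac_algebraMap, hde,
      sub_self]) f
  rwa [commutator_apply, sub_eq_zero] at h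

end Derivation

/-! ### Triangular changes of variables -/

namespace MvPolynomial

theorem aeval_congr_of_mem_supported {K A : Type*} [CommRing K] [CommRing A] [Algebra K A]
    {s : Set ℕ} {p : MvPolynomial ℕ K} (hp : p ∈ supported K s) {g g' : ℕ → A}
    (h : ∀ i ∈ s, g i = g' i) : aeval g p = aeval g' p :=
  eval₂Hom_congr' rfl (fun i hi _ => h i (mem_supported.mp hp hi)) rfl

theorem pderiv_pderiv_comm {K : Type*} [CommRing K] (i j : ℕ) (p : MvPolynomial ℕ K) :
    pderiv i (pderiv j p) = pderiv j (pderiv i p) := by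
  have hX : ∀ i j k : ℕ, pderiv i (pderiv j (X k : MvPolynomial ℕ K)) = 0 := fun i j k => by
    rcases eq_or_ne k j with rfl | h
    · rw [pderiv_X_self, pderiv_one]
    · rw [pderiv_X_of_ne h, map_zero]
  have h : ⁅pderiv i, pderiv j⁆ = (0 : Derivation K (MvPolynomial ℕ K) (MvPolynomial ℕ K)) :=
    derivation_ext fun k => by
      rw [Derivation.commutator_apply, hX, hX, sub_zero, Derivation.zero_apply]
  rw [← sub_eq_zero, ← Derivation.commutator_apply, h, Derivation.zero_apply]

theorem pderiv_mem_supported {K : Type*} [CommRing K] {s : Set ℕ} {p : MvPolynomial ℕ K}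
    (hp : p ∈ supported K s) (i : ℕ) : pderiv i p ∈ supported K s := by
  rw [supported_eq_adjoin_X] at hp
  induction hp using Algebra.adjoin_induction with
  | mem x hx =>
    obtain ⟨j, _, rfl⟩ := hx
    rw [pderiv_X]
    rcases eq_or_ne j i with rfl | hij
    · rw [Pi.single_eq_same]; exact one_mem _
    · rw [Pi.single_eq_of_ne hij]; exact zero_mem _
  | algebraMap r => rw [Derivation.map_algebraMap]; exact zero_mem _
  | add x y _ _ hx hy => rw [map_add]; exact add_mem hx hy
  | mul x y hx' hy' hx hy =>
    rw [Derivation.leibniz, smul_eq_mul, smul_eq_mul]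
    rw [← supported_eq_adjoin_X] at hx' hy'
    exact add_mem (mul_mem hx' hy) (mul_mem hy' hx)

section Triangular

variable {K : Type*} [Field K] (a : ℕ → K) (r : ℕ → MvPolynomial ℕ K)

/-- The inverse of the triangular substitution `X k ↦ a k X k + r k`. -/
noncomputable def triangularInverse (k : ℕ) : MvPolynomial ℕ K :=
  C (a k)⁻¹ * (X k - aeval (fun i => if _h : i < k then triangularInverse i else 0) (r k))
termination_by k

variable {a r}

/-- The guard `i < k` serves only the termination of the recursion. The default value `0` is never
used, since `r k` involves only smaller variables. -/
theorem triangularInverse_eq (hr : ∀ k, r k ∈ supported K (Set.Iio k)) (k : ℕ) :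
    triangularInverse a r k = C (a k)⁻¹ * (X k - aeval (triangularInverse a r) (r k)) := by
  rw [triangularInverse]
  congr 2
  exact aeval_congr_of_mem_supported (hr k) fun i hi => dif_pos hi

theorem bijective_aeval_triangular (ha : ∀ k, a k ≠ 0)
    (hr : ∀ k, r k ∈ supported K (Set.Iio k)) {q : ℕ → MvPolynomial ℕ K}
    (hq : ∀ k, q k = C (a k) * X k + r k) :
    Function.Bijective (aeval q : MvPolynomial ℕ K →ₐ[K] MvPolynomial ℕ K) := by
  have h1 : (aeval (triangularInverse a r)).comp (aeval q) = AlgHom.id K _ := by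
    refine algHom_ext fun k => ?_
    rw [AlgHom.comp_apply, aeval_X, hq, map_add, map_mul, algHom_C, aeval_X,
      triangularInverse_eq hr, AlgHom.id_apply, algebraMap_eq, ← mul_assoc, ← map_mul,
      mul_inv_cancel₀ (ha k), map_one, one_mul, sub_add_cancel]
  have h2 : (aeval q).comp (aeval (triangularInverse a r)) = AlgHom.id K _ := by
    refine algHom_ext fun k => ?_
    rw [AlgHom.comp_apply, aeval_X, AlgHom.id_apply]
    induction k using Nat.strong_induction_on with
    | _ k ih =>
      have h3 : aeval q (aeval (triangularInverse a r) (r k)) = r k := by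
        rw [← AlgHom.comp_apply, comp_aeval]
        refine (aeval_congr_of_mem_supported (hr k) (g' := X) fun i hi => ih i hi).trans ?_
        rw [aeval_X_left, AlgHom.id_apply]
      rw [triangularInverse_eq hr, map_mul, map_sub, h3, aeval_X, algHom_C, algebraMap_eq, hq,
        add_sub_cancel_right, ← mul_assoc, ← map_mul, inv_mul_cancel₀ (ha k), map_one, one_mul]
  refine Function.bijective_iff_has_inverse.mpr ⟨aeval (triangularInverse a r), fun p => ?_,
    fun p => ?_⟩
  · rw [← AlgHom.comp_apply, h1, AlgHom.id_apply]
  · rw [← AlgHom.comp_apply, h2, AlgHom.id_apply]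

end Triangular

end MvPolynomial

/-! ### More on Darboux chains -/

namespace PsiDO

variable {F : Type*} [Field F] [Differential F]

theorem dress_congr {f f' : ℕ → F} {n : ℕ} (h : ∀ i < n, f i = f' i) :
    dress f n = dress f' n := by
  induction n with
  | zero => rfl
  | succ n ih =>
    have e := ih fun i hi => h i (by omega)
    rw [dress_succ, dress_succ, pivot, pivot, e, h n (by omega)]

/-- Induction on the factors, with `g_n = pivot f n`: for constant `c`, the factor of `g_{n+1}`
sends `c / g_n` to `-c (g_n g_{n+1})' / (g_n² g_{n+1})`, which is `-c / g_{n+1}` by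
`deriv_pivot_mul_pivot`. The start `-1 / f 0` uses `(f 0)′ = 1`. -/
theorem dress_apply_one {f : ℕ → F} (hf₀ : (f 0)′ = 1) (hf : ∀ j, (f (j + 1))′′ = f j)
    (hne : f 0 ≠ 0) (n : ℕ) :
    (dress f (n + 1)).apply 1 = (-1) ^ (n + 1) / pivot f n := by
  have hf₀' : (f 0)′′ = 0 := by rw [hf₀, Derivation.map_one_eq_zero]
  induction n with
  | zero =>
    have h0 : pivot f 0 = f 0 := one_apply _
    rw [dress_succ, show dress f 0 = 1 from rfl, mul_one, darbouxFactor_apply,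
      Derivation.map_one_eq_zero, Differential.logDeriv, h0, hf₀]
    ring
  | succ n ih =>
    have h1 := pivot_ne_zero hf₀' hf hne n
    have h2 := pivot_ne_zero hf₀' hf hne (n + 1)
    have h3 := deriv_pivot_mul_pivot hf₀' hf (n := n) fun i _ => pivot_ne_zero hf₀' hf hne i
    have h4 : ((-1 : F) ^ (n + 1))′ = 0 := by
      rw [Derivation.leibniz_pow, map_neg, Derivation.map_one_eq_zero, neg_zero, smul_zero,
        smul_zero]
    rw [dress_succ, apply_mul (isDiff_darbouxFactor _) (isDiff_dress _), ih, darbouxFactor_apply,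
      Differential.logDeriv, Derivation.leibniz_div, h4]
    rw [Derivation.leibniz] at h3
    simp only [smul_eq_mul] at h3 ⊢
    field_simp
    rw [pow_succ (-1 : F) (n + 1)]
    linear_combination -(-1 : F) ^ (n + 1) * h3

end PsiDO

/-! ### Derivatives and Wronskians of polynomials inside the field of rational functions -/

namespace AdlerMoser

open MvPolynomial PsiDO

variable (K : Type*) [Field K]

theorem deriv_algebraMap (p : MvPolynomial ℕ K) :
    (algebraMap _ (RatFun K) p)′ = algebraMap _ (RatFun K) (pderiv 0 p) :=
  Derivation.frac_algebraMap _ _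

theorem iterate_deriv_algebraMap (m : ℕ) (p : MvPolynomial ℕ K) :
    (fun f : RatFun K => f′)^[m] (algebraMap _ (RatFun K) p) =
      algebraMap _ (RatFun K) ((fun g : MvPolynomial ℕ K => pderiv 0 g)^[m] p) := by
  induction m generalizing p with
  | zero => rfl
  | succ m ih => rw [Function.iterate_succ_apply, deriv_algebraMap, ih, Function.iterate_succ_apply]

theorem dt_algebraMap (k : ℕ) (p : MvPolynomial ℕ K) :
    dt K k (algebraMap _ (RatFun K) p) = algebraMap _ (RatFun K) (pderiv k p) :=
  Derivation.frac_algebraMap _ _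

theorem dt_deriv (k : ℕ) (f : RatFun K) : dt K k f′ = (dt K k f)′ :=
  Derivation.frac_comm _ _ (fun p => pderiv_pderiv_comm k 0 p) f

theorem algebraMap_injective : Function.Injective (algebraMap (MvPolynomial ℕ K) (RatFun K)) :=
  IsFractionRing.injective _ _

instance [CharZero K] : CharZero (RatFun K) :=
  charZero_of_injective_algebraMap (algebraMap_injective K)

variable {K}

theorem algebraMap_wronskian (n : ℕ) (p : ℕ → MvPolynomial ℕ K) :
    algebraMap _ (RatFun K) (wronskian n p) =
      ∏ i ∈ Finset.range n, pivot (fun j => algebraMap _ (RatFun K) (p j)) i := by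
  rw [← det_wronskian, wronskian, RingHom.map_det]
  congr 1
  ext i j
  exact (iterate_deriv_algebraMap K i (p j)).symm

theorem wronskian_mem_supported {s : Set ℕ} {n : ℕ} {p : ℕ → MvPolynomial ℕ K}
    (hp : ∀ i < n, p i ∈ supported K s) : wronskian n p ∈ supported K s := by
  have hiter : ∀ (m : ℕ) (g : MvPolynomial ℕ K), g ∈ supported K s →
      (fun g : MvPolynomial ℕ K => pderiv 0 g)^[m] g ∈ supported K s := by
    intro m
    induction m with
    | zero => exact fun g hg => hg
    | succ m ih => exact fun g hg => ih _ (pderiv_mem_supported hg 0)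
  rw [wronskian, Matrix.det_apply]
  refine sum_mem fun σ _ => ?_
  rw [Units.smul_def]
  refine zsmul_mem (prod_mem fun i _ => ?_) _
  exact hiter (σ i : ℕ) (p i) (hp i i.isLt)

/-! ### The normalisation constants -/

variable (K)

/-- The double factorial `1 · 3 ⋯ (2n - 1)`. -/
def oddProd (n : ℕ) : K := ∏ i ∈ Finset.range n, (2 * (i : K) + 1)

theorem mu_eq (n : ℕ) : mu K n = ∏ i ∈ Finset.range n, (2 * (i : K) + 1) ^ (n - i) := by
  rw [mu]
  refine Finset.prod_nbij' (fun j => n - j) (fun i => n - i) ?_ ?_ ?_ ?_ ?_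
  · intro j hj
    rw [Finset.mem_Icc] at hj
    rw [Finset.mem_range]
    omega
  · intro i hi
    rw [Finset.mem_range] at hi
    rw [Finset.mem_Icc]
    omega
  · intro j hj
    rw [Finset.mem_Icc] at hj
    omega
  · intro i hi
    rw [Finset.mem_range] at hi
    omega
  · intro j hj
    rw [Finset.mem_Icc] at hj
    rw [Nat.cast_sub hj.2, Nat.sub_sub_self hj.2]

theorem mu_succ (n : ℕ) : mu K (n + 1) = mu K n * oddProd K (n + 1) := by
  have h : mu K n = ∏ i ∈ Finset.range (n + 1), (2 * (i : K) + 1) ^ (n - i) := by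
    rw [Finset.prod_range_succ, Nat.sub_self, pow_zero, mul_one, mu_eq]
  rw [h, mu_eq, oddProd, ← Finset.prod_mul_distrib]
  refine Finset.prod_congr rfl fun i hi => ?_
  rw [Finset.mem_range] at hi
  rw [← pow_succ, Nat.sub_add_comm (by omega)]

theorem alpha_eq (k : ℕ) : alpha K k = (-1) ^ k * (oddProd K k * oddProd K (k + 1)) := by
  have h : ∀ m, oddProd K (m + 1) = ∏ j ∈ Finset.Icc 1 m, (2 * (j : K) + 1) := by
    intro m
    induction m with
    | zero => simp [oddProd]
    | succ m ih =>
      rw [oddProd, Finset.prod_range_succ, ← oddProd, ih, Finset.prod_Icc_succ_top (by omega)]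
  rcases k with _ | k
  · simp [alpha, oddProd]
  · rw [alpha, Finset.prod_pow, Nat.add_sub_cancel, ← h]
    conv_rhs => rw [oddProd.eq_def K (k + 1 + 1), Finset.prod_range_succ, ← oddProd]
    ring

theorem mu_mul_mu (n : ℕ) : mu K (n + 2) * mu K n = (2 * ((n + 1 : ℕ) : K) + 1) *
    mu K (n + 1) ^ 2 := by
  rw [mu_succ K (n + 1), mu_succ K n, oddProd.eq_def K (n + 1 + 1), Finset.prod_range_succ,
    ← oddProd]
  ring

section CharZero

variable [CharZero K]

theorem oddProd_ne_zero (n : ℕ) : oddProd K n ≠ 0 :=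
  Finset.prod_ne_zero_iff.mpr fun i _ => by exact_mod_cast Nat.succ_ne_zero (2 * i)

theorem mu_ne_zero (n : ℕ) : mu K n ≠ 0 := by
  rw [mu_eq]
  exact Finset.prod_ne_zero_iff.mpr fun i _ =>
    pow_ne_zero _ (by exact_mod_cast Nat.succ_ne_zero (2 * i))

theorem alpha_ne_zero (k : ℕ) : alpha K k ≠ 0 := by
  rw [alpha_eq]
  exact mul_ne_zero (pow_ne_zero _ (neg_ne_zero.mpr one_ne_zero))
    (mul_ne_zero (oddProd_ne_zero K _) (oddProd_ne_zero K _))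

/-- This is what fixes `α`: the ratio `μ_{n+2} / μ_n = (2n+1)!! (2n+3)!!` is `α_{2n+3}` up to the
sign `(-1)^(n+1)` coming from the Wronskian. -/
theorem mu_mul_inv_alpha (n : ℕ) :
    mu K (n + 2) * ((-1) ^ (n + 1) * (alpha K (n + 1))⁻¹) = mu K n := by
  have h1 := oddProd_ne_zero K (n + 1)
  have h2 := oddProd_ne_zero K (n + 2)
  rw [mu_succ K (n + 1), mu_succ K n, alpha_eq]
  field_simp

end CharZero

end AdlerMoser

namespace AdlerMoser

open MvPolynomial PsiDO

variable (K : Type*) [Field K] [CharZero K]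

/-! ### The change of variables -/

theorem qOfT_zero : qOfT K 0 = X 0 := if_pos rfl

theorem qOfT_of_pos {k : ℕ} (hk : 1 ≤ k) :
    qOfT K k = C (alpha K k) * PowerSeries.coeff (2 * k + 1) (tanhTimes K) := if_neg (by omega)

theorem bijective_aeval_qOfT : Function.Bijective
    (aeval (qOfT K) : MvPolynomial ℕ K →ₐ[K] MvPolynomial ℕ K) := by
  refine bijective_aeval_triangular (a := alpha K) (r := fun k => if k = 0 then 0 else
    C (alpha K k) * (PowerSeries.coeff (2 * k + 1) (tanhTimes K) - X k)) (alpha_ne_zero K) ?_ ?_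
  · intro k
    split_ifs with h
    · exact zero_mem _
    · exact mul_mem (Subalgebra.algebraMap_mem _ _)
        (coeff_tanhTimes_sub_mem K (Nat.one_le_iff_ne_zero.mpr h))
  · intro k
    split_ifs with h
    · rw [h, qOfT_zero, show alpha K 0 = 1 by simp [alpha], map_one, one_mul, add_zero]
    · rw [qOfT_of_pos K (Nat.one_le_iff_ne_zero.mpr h)]
      ring

/-- `qOfT` records only the odd coefficients from `z³` on; nothing is lost because `tanh T` is odd
and starts at `z³`. -/
theorem oddSeries_qOfT :
    oddSeries (fun k => C (alpha K k)⁻¹ * qOfT K k) = tanhTimes K := by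
  ext1 n
  rw [coeff_oddSeries]
  split_ifs with h
  · rw [qOfT_of_pos K (by omega), ← mul_assoc, ← map_mul, inv_mul_cancel₀ (alpha_ne_zero K _),
      map_one, one_mul]
    obtain ⟨j, hj⟩ := h.1
    congr 2
    omega
  · rcases Nat.even_or_odd n with hn | hn
    · exact (coeff_tanhTimes_of_even K hn).symm
    · exact (coeff_tanhTimes_of_lt K (not_le.mp fun h3 => h ⟨hn, h3⟩)).symm

theorem pderiv_zero_qOfT {k : ℕ} (hk : 1 ≤ k) : pderiv 0 (qOfT K k) = 0 := by
  rw [qOfT_of_pos K hk, pderiv_C_mul, ← coeff_dSeries, dSeries_zero_tanhTimes, map_zero, mul_zero]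

/-- Only `q₁ = x` depends on `x`. Consequently the substitution commutes with the formation of
Wronskians. -/
theorem pderiv_zero_aeval_qOfT (p : MvPolynomial ℕ K) :
    pderiv 0 (aeval (qOfT K) p) = aeval (qOfT K) (pderiv 0 p) := by
  induction p using MvPolynomial.induction_on with
  | C a => rw [algHom_C, algebraMap_eq, pderiv_C, map_zero]
  | add p q hp hq => rw [map_add, map_add, map_add, map_add, hp, hq]
  | mul_X p k hp =>
    rw [map_mul, pderiv_mul, pderiv_mul, map_add, map_mul, map_mul, hp, aeval_X]
    congr 2
    rcases Nat.eq_zero_or_pos k with rfl | hk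
    · rw [qOfT_zero, pderiv_X_self, map_one]
    · rw [pderiv_zero_qOfT K hk, pderiv_X_of_ne (by omega), map_zero]

/-! ### The functions `ψ_j` -/

section Wave

variable {K} {Θ : PowerSeries (MvPolynomial ℕ K)}

theorem coeff_one_waveSeries (h0 : PowerSeries.coeff 0 Θ = 0) (h1 : PowerSeries.coeff 1 Θ = 0) :
    PowerSeries.coeff 1 (waveSeries K Θ) = X 0 := by
  have ha : Finset.HasAntidiagonal.antidiagonal 1 = {((0, 1) : ℕ × ℕ), (1, 0)} := rfl
  rw [waveSeries, map_add, coeff_sinhX, if_pos odd_one, PowerSeries.coeff_mul, ha,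
    Finset.sum_pair (by simp), h0, h1, mul_zero, mul_zero, add_zero, add_zero]
  simp

theorem pderiv_pderiv_coeff_waveSeries (hΘ : dSeries K 0 Θ = 0) (n : ℕ) :
    pderiv 0 (pderiv 0 (PowerSeries.coeff n (waveSeries K Θ))) =
      if 2 ≤ n then PowerSeries.coeff (n - 2) (waveSeries K Θ) else 0 := by
  rw [← coeff_dSeries, ← coeff_dSeries, dSeries_zero_zero_waveSeries hΘ,
    PowerSeries.coeff_X_pow_mul']

end Wave

theorem psi_eq (k : ℕ) : psi K k = PowerSeries.coeff (2 * k + 1)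
    (waveSeries K (oddSeries fun i => C (alpha K i)⁻¹ * X i)) := rfl

theorem psi_zero : psi K 0 = X 0 := by
  rw [psi_eq]
  exact coeff_one_waveSeries (by rw [coeff_oddSeries, if_neg (by simp)])
    (by rw [coeff_oddSeries, if_neg (by simp)])

theorem pderiv_pderiv_psi_succ (k : ℕ) : pderiv 0 (pderiv 0 (psi K (k + 1))) = psi K k := by
  rw [psi_eq, pderiv_pderiv_coeff_waveSeries (dSeries_zero_oddSeries K fun i hi => by
    rw [pderiv_C_mul, pderiv_X_of_ne (by omega), mul_zero]), if_pos (by omega), psi_eq]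
  rfl

/-- For `k ≥ 1` the variable `X k` enters only through the constant term of `cosh (x z)` times the
coefficient of `z^(2k+1)` in the odd series; every other product involves earlier variables. -/
theorem psi_sub_mem_supported (k : ℕ) :
    psi K k - C (alpha K k)⁻¹ * X k ∈ supported K (Set.Iio (max k 1)) := by
  rcases Nat.eq_zero_or_pos k with rfl | hk
  · rw [psi_zero, show alpha K 0 = 1 by simp [alpha], inv_one, map_one, one_mul, sub_self]
    exact zero_mem _
  have hX : (X 0 : MvPolynomial ℕ K) ∈ supported K (Set.Iio (max k 1)) :=
    X_mem_supported.mpr (Set.mem_Iio.mpr (by omega))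
  have hC : ∀ c : K, (C c : MvPolynomial ℕ K) ∈ supported K (Set.Iio (max k 1)) :=
    fun c => Subalgebra.algebraMap_mem _ _
  rw [psi_eq, waveSeries, map_add, PowerSeries.coeff_mul, ← Finset.add_sum_erase _ _
    (Finset.HasAntidiagonal.mem_antidiagonal.mpr (zero_add (2 * k + 1)) :
      (0, 2 * k + 1) ∈ Finset.HasAntidiagonal.antidiagonal (2 * k + 1)),
    coeff_oddSeries, if_pos ⟨⟨k, rfl⟩, by omega⟩, coeff_coshX, if_pos (by simp),
    show (2 * k + 1) / 2 = k by omega, pow_zero, Nat.factorial_zero, Nat.cast_one, inv_one, map_one,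
    one_mul, one_mul, add_comm (C (alpha K k)⁻¹ * X k), ← add_assoc, add_sub_cancel_right]
  refine add_mem ?_ (sum_mem fun p hp => ?_)
  · rw [coeff_sinhX]
    split_ifs
    · exact mul_mem (pow_mem hX _) (hC _)
    · exact zero_mem _
  · rw [Finset.mem_erase, Finset.HasAntidiagonal.mem_antidiagonal] at hp
    refine mul_mem ?_ ?_
    · rw [coeff_coshX]
      split_ifs
      · exact mul_mem (pow_mem hX _) (hC _)
      · exact zero_mem _
    · rw [coeff_oddSeries]
      split_ifs with h
      · refine mul_mem (hC _) (X_mem_supported.mpr (Set.mem_Iio.mpr ?_))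
        have hne : p.1 ≠ 0 := fun h0 => hp.1 (Prod.ext h0 (by dsimp only; omega))
        obtain ⟨j, hj⟩ := h.1
        omega
      · exact zero_mem _

theorem psi_mem_supported {k m : ℕ} (hk : k < m) : psi K k ∈ supported K (Set.Iio m) := by
  have h := supported_mono (R := K) (Set.Iio_subset_Iio (show max k 1 ≤ m by omega))
    (psi_sub_mem_supported K k)
  rw [← sub_add_cancel (psi K k) (C (alpha K k)⁻¹ * X k)]
  exact add_mem h (mul_mem (Subalgebra.algebraMap_mem _ _) (X_mem_supported.mpr hk))

/-! ### The Adler–Moser recursion -/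

/-- `ψ_{j+1}` as a rational function. -/
noncomputable def psiRat (j : ℕ) : RatFun K := algebraMap _ (RatFun K) (psi K j)

theorem psiRat_zero : psiRat K 0 = algebraMap _ (RatFun K) (X 0 : MvPolynomial ℕ K) := by rw [psiRat, psi_zero]

theorem deriv_psiRat_zero : (psiRat K 0)′ = 1 := by
  rw [psiRat_zero, deriv_algebraMap, pderiv_X_self, map_one]

theorem deriv_deriv_psiRat_zero : (psiRat K 0)′′ = 0 := by
  rw [deriv_psiRat_zero, Derivation.map_one_eq_zero]

theorem psiRat_zero_ne_zero : psiRat K 0 ≠ 0 := by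
  rw [psiRat_zero, Ne, map_eq_zero_iff _ (algebraMap_injective K)]
  exact X_ne_zero 0

theorem deriv_deriv_psiRat_succ (j : ℕ) : (psiRat K (j + 1))′′ = psiRat K j := by
  rw [psiRat, deriv_algebraMap, deriv_algebraMap, pderiv_pderiv_psi_succ, psiRat]

theorem algebraMap_wronskian_psi (n : ℕ) : algebraMap _ (RatFun K) (wronskian n (psi K)) =
    ∏ i ∈ Finset.range n, pivot (psiRat K) i := algebraMap_wronskian n (psi K)

theorem pivot_psiRat_ne_zero (n : ℕ) : pivot (psiRat K) n ≠ 0 :=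
  pivot_ne_zero (deriv_deriv_psiRat_zero K) (deriv_deriv_psiRat_succ K) (psiRat_zero_ne_zero K) n

/-- Since `W_{n+2} / W_n` is the product of the pivots `n` and `n + 1`, this is
`deriv_pivot_mul_pivot` multiplied by `W_n²`. -/
theorem wronskian_recursion (n : ℕ) :
    pderiv 0 (wronskian (n + 2) (psi K)) * wronskian n (psi K) -
      wronskian (n + 2) (psi K) * pderiv 0 (wronskian n (psi K)) =
        wronskian (n + 1) (psi K) ^ 2 := by
  apply algebraMap_injective K
  have h := deriv_pivot_mul_pivot (deriv_deriv_psiRat_zero K) (deriv_deriv_psiRat_succ K) (n := n)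
    fun i _ => pivot_psiRat_ne_zero K i
  rw [map_sub, map_mul, map_mul, map_pow, ← deriv_algebraMap, ← deriv_algebraMap,
    algebraMap_wronskian_psi, algebraMap_wronskian_psi, algebraMap_wronskian_psi,
    Finset.prod_range_succ _ (n + 1), Finset.prod_range_succ, mul_assoc, Derivation.leibniz, h]
  simp only [smul_eq_mul]
  ring

theorem theta_recursion (n : ℕ) :
    pderiv 0 (theta K (n + 2)) * theta K n - theta K (n + 2) * pderiv 0 (theta K n) =
      (2 * ((n + 1 : ℕ) : MvPolynomial ℕ K) + 1) * theta K (n + 1) ^ 2 := by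
  have hmu : (C (mu K (n + 2)) * C (mu K n) : MvPolynomial ℕ K) =
      (2 * ((n + 1 : ℕ) : MvPolynomial ℕ K) + 1) * C (mu K (n + 1)) ^ 2 := by
    rw [← map_mul, mu_mul_mu, map_mul, map_pow, map_add, map_mul, map_one, map_natCast, map_ofNat]
  rw [theta, theta, theta, pderiv_C_mul, pderiv_C_mul]
  linear_combination C (mu K (n + 2)) * C (mu K n) * wronskian_recursion K n +
    wronskian (n + 1) (psi K) ^ 2 * hmu

theorem theta_zero : theta K 0 = 1 := by
  rw [theta, wronskian, Matrix.det_isEmpty]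
  simp [mu]

theorem theta_one : theta K 1 = X 0 := by
  rw [theta, wronskian, Matrix.det_unique, show mu K 1 = 1 by simp [mu], map_one, one_mul,
    Matrix.of_apply]
  exact psi_zero K

/-- Only the last pivot changes, by `c` times the value of the dressing operator at `1`, that is, by
`(-1)^(n+1) c / g_n`. Multiplying by the earlier pivots `W_{n+1} = W_n g_n` gives the extra term. -/
theorem wronskian_add_const (n : ℕ) (p : MvPolynomial ℕ K) (c : MvPolynomial ℕ K)
    (hc : pderiv 0 c = 0) (hp : psi K (n + 1) = p + c) :
    wronskian (n + 2) (psi K) = wronskian (n + 2) (Function.update (psi K) (n + 1) p) +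
      (-1) ^ (n + 1) * c * wronskian n (psi K) := by
  apply algebraMap_injective K
  set f : ℕ → RatFun K := fun j => algebraMap _ (RatFun K) (Function.update (psi K) (n + 1) p j)
    with hf
  have hfi : ∀ i < n + 1, psiRat K i = f i := fun i hi => by
    rw [hf, psiRat]
    dsimp only
    rw [Function.update_of_ne (by omega)]
  have hpiv : ∀ i < n + 1, pivot f i = pivot (psiRat K) i := fun i hi => by
    rw [pivot, pivot, dress_congr fun j hj => hfi j (by omega), hfi i hi]
  have hc' : (algebraMap _ (RatFun K) c)′ = 0 := by rw [deriv_algebraMap, hc, map_zero]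
  have hlast : pivot (psiRat K) (n + 1) = pivot f (n + 1) +
      algebraMap _ (RatFun K) c * ((-1) ^ (n + 1) / pivot (psiRat K) n) := by
    have h1 : psiRat K (n + 1) = f (n + 1) + algebraMap _ (RatFun K) c * 1 := by
      rw [hf, psiRat, hp, map_add, mul_one]
      dsimp only
      rw [Function.update_self]
    rw [pivot, h1, apply_add, apply_mul_of_deriv_eq_zero _ hc', dress_apply_one
      (deriv_psiRat_zero K) (deriv_deriv_psiRat_succ K) (psiRat_zero_ne_zero K),
      dress_congr hfi]
    rfl
  have hn := pivot_psiRat_ne_zero K n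
  rw [map_add, map_mul, map_mul, map_pow, map_neg, map_one, algebraMap_wronskian_psi,
    algebraMap_wronskian_psi, algebraMap_wronskian]
  change _ = ∏ i ∈ Finset.range (n + 2), pivot f i + _
  rw [Finset.prod_range_succ _ (n + 1), Finset.prod_range_succ _ (n + 1), hlast,
    Finset.prod_congr rfl fun i hi => hpiv i (Finset.mem_range.mp hi), mul_add,
    Finset.prod_range_succ _ n]
  field_simp

theorem theta_integration_constant (n : ℕ) : ∃ f : MvPolynomial ℕ K,
    f.vars ⊆ Finset.range (n + 1) ∧ theta K (n + 2) = f + X (n + 1) * theta K n := by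
  set p := psi K (n + 1) - C (alpha K (n + 1))⁻¹ * X (n + 1) with hp
  have hW := wronskian_add_const K n p (C (alpha K (n + 1))⁻¹ * X (n + 1))
    (by rw [pderiv_C_mul, pderiv_X_of_ne (by omega), mul_zero]) (by rw [hp, sub_add_cancel])
  refine ⟨C (mu K (n + 2)) * wronskian (n + 2) (Function.update (psi K) (n + 1) p), ?_, ?_⟩
  · have h : C (mu K (n + 2)) * wronskian (n + 2) (Function.update (psi K) (n + 1) p) ∈
        supported K (Set.Iio (n + 1)) := by
      refine mul_mem (Subalgebra.algebraMap_mem _ _) (wronskian_mem_supported fun i hi => ?_)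
      rcases (Nat.lt_succ_iff.mp hi).lt_or_eq with h | rfl
      · rw [Function.update_of_ne (by omega)]
        exact psi_mem_supported K h
      · rw [Function.update_self]
        have := psi_sub_mem_supported K (n + 1)
        rwa [max_eq_left (by omega)] at this
    intro i hi
    exact Finset.mem_range.mpr (mem_supported.mp h hi)
  · have hmu : (C (mu K (n + 2)) * ((-1) ^ (n + 1) * C (alpha K (n + 1))⁻¹) : MvPolynomial ℕ K) =
        C (mu K n) := by
      rw [← mu_mul_inv_alpha K n, map_mul, map_mul, map_pow, map_neg, map_one]
    rw [theta, theta, hW]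
    linear_combination X (n + 1) * wronskian n (psi K) * hmu

/-! ### The tau functions -/

/-- The image of `ψ_{j+1}` under the change of variables. -/
noncomputable def psiTime (j : ℕ) : MvPolynomial ℕ K := aeval (qOfT K) (psi K j)

theorem psiTime_eq (j : ℕ) :
    psiTime K j = PowerSeries.coeff (2 * j + 1) (waveSeries K (tanhTimes K)) := by
  have hs : ∀ n, aeval (qOfT K) (PowerSeries.coeff n (sinhX K)) =
      PowerSeries.coeff n (sinhX K) := fun n => by
    rw [coeff_sinhX, apply_ite (aeval (qOfT K)), map_mul, map_pow, aeval_X, qOfT_zero, algHom_C,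
      map_zero, algebraMap_eq]
  have hc : ∀ n, aeval (qOfT K) (PowerSeries.coeff n (coshX K)) =
      PowerSeries.coeff n (coshX K) := fun n => by
    rw [coeff_coshX, apply_ite (aeval (qOfT K)), map_mul, map_pow, aeval_X, qOfT_zero, algHom_C,
      map_zero, algebraMap_eq]
  have ho : ∀ n, aeval (qOfT K) (PowerSeries.coeff n (oddSeries fun i =>
      (C (alpha K i)⁻¹ * X i : MvPolynomial ℕ K))) = PowerSeries.coeff n (tanhTimes K) := fun n => by
    rw [← oddSeries_qOfT, coeff_oddSeries, coeff_oddSeries, apply_ite (aeval (qOfT K)), map_mul,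
      aeval_X, algHom_C, map_zero, algebraMap_eq]
  rw [psiTime, psi_eq, waveSeries, waveSeries, map_add, map_add, map_add, hs,
    PowerSeries.coeff_mul, PowerSeries.coeff_mul, map_sum]
  congr 1
  exact Finset.sum_congr rfl fun p _ => by rw [map_mul, hc, ho]

theorem wronskian_psiTime (n : ℕ) :
    wronskian n (psiTime K) = aeval (qOfT K) (wronskian n (psi K)) := by
  have hiter : ∀ (m : ℕ) (p : MvPolynomial ℕ K), (fun g : MvPolynomial ℕ K => pderiv 0 g)^[m]
      (aeval (qOfT K) p) = aeval (qOfT K) ((fun g : MvPolynomial ℕ K => pderiv 0 g)^[m] p) := by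
    intro m
    induction m with
    | zero => exact fun _ => rfl
    | succ m ih =>
      intro p
      rw [Function.iterate_succ_apply, pderiv_zero_aeval_qOfT, ih, Function.iterate_succ_apply]
  rw [wronskian, wronskian, AlgHom.map_det]
  congr 1
  ext1 i j
  exact hiter i (psi K j)

theorem tau_eq (n : ℕ) : tau K n = C (mu K n) * wronskian n (psiTime K) := by
  rw [tau, theta, map_mul, algHom_C, algebraMap_eq, wronskian_psiTime]

/-- The functions `ψ_{j+1}` of the times, as rational functions. -/
noncomputable def psiTimeRat (j : ℕ) : RatFun K := algebraMap _ (RatFun K) (psiTime K j)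

theorem psiTimeRat_zero : psiTimeRat K 0 = algebraMap _ (RatFun K) (X 0 : MvPolynomial ℕ K) := by
  rw [psiTimeRat, psiTime, psi_zero, aeval_X, qOfT_zero]

theorem psiTimeRat_zero_ne_zero : psiTimeRat K 0 ≠ 0 := by
  rw [psiTimeRat_zero, Ne, map_eq_zero_iff _ (algebraMap_injective K)]
  exact X_ne_zero 0

theorem deriv_deriv_psiTimeRat_zero : (psiTimeRat K 0)′′ = 0 := by
  rw [psiTimeRat_zero, deriv_algebraMap, pderiv_X_self, map_one, Derivation.map_one_eq_zero]

theorem deriv_deriv_psiTimeRat_succ (j : ℕ) : (psiTimeRat K (j + 1))′′ = psiTimeRat K j := by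
  rw [psiTimeRat, deriv_algebraMap, deriv_algebraMap, psiTime, pderiv_zero_aeval_qOfT,
    pderiv_zero_aeval_qOfT, pderiv_pderiv_psi_succ]
  rfl

theorem algebraMap_tau (n : ℕ) : algebraMap _ (RatFun K) (tau K n) =
    algebraMap _ (RatFun K) (C (mu K n) : MvPolynomial ℕ K) * ∏ i ∈ Finset.range n, pivot (psiTimeRat K) i := by
  rw [tau_eq, map_mul, algebraMap_wronskian]
  rfl

theorem pivot_psiTimeRat_ne_zero (n : ℕ) : pivot (psiTimeRat K) n ≠ 0 :=
  pivot_ne_zero (deriv_deriv_psiTimeRat_zero K) (deriv_deriv_psiTimeRat_succ K)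
    (psiTimeRat_zero_ne_zero K) n

theorem algebraMap_C_mu_ne_zero (n : ℕ) : algebraMap _ (RatFun K) (C (mu K n) : MvPolynomial ℕ K) ≠ 0 := by
  rw [Ne, map_eq_zero_iff _ (algebraMap_injective K), map_eq_zero_iff _ (C_injective ℕ K)]
  exact mu_ne_zero K n

theorem tau_ne_zero (n : ℕ) : tau K n ≠ 0 := by
  intro h
  have h1 := algebraMap_tau K n
  rw [h, map_zero] at h1
  exact mul_ne_zero (algebraMap_C_mu_ne_zero K n)
    (Finset.prod_ne_zero_iff.mpr fun i _ => pivot_psiTimeRat_ne_zero K i) h1.symm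

/-- The constant `μ_n` disappears from the logarithmic derivative. -/
theorem potential_tau (n : ℕ) : potential (tau K n) = chainPotential (psiTimeRat K) n := by
  rw [chainPotential_eq (deriv_deriv_psiTimeRat_zero K) (deriv_deriv_psiTimeRat_succ K)
    (psiTimeRat_zero_ne_zero K)]
  change 2 * (Differential.logDeriv (algebraMap _ (RatFun K) (tau K n)))′ = _
  rw [algebraMap_tau, Differential.logDeriv_mul _ _ (algebraMap_C_mu_ne_zero K n)
    (Finset.prod_ne_zero_iff.mpr fun i _ => pivot_psiTimeRat_ne_zero K i),
    (Differential.logDeriv_eq_zero _).mpr (by rw [deriv_algebraMap, pderiv_C, map_zero]), zero_add]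

/-- The coefficient of `z^(2j+1)` in the evolution equation of the wave series. That series is odd
in `z`, so the correction term involves only its coefficients at `z^(2i+1)` with `i ≤ j`, multiplied
by coefficients of `z^(2k+1) tanh T`, which are free of `x`. -/
theorem dt_psiTimeRat (k : ℕ) : ∃ c : ℕ → ℕ → RatFun K, (∀ j i, (c j i)′ = 0) ∧
    ∀ j, dt K k (psiTimeRat K j) = (fun g : RatFun K => g′)^[2 * k + 1] (psiTimeRat K j) +
      ∑ i ∈ Finset.range (j + 1), c j i * psiTimeRat K i := by
  rcases Nat.eq_zero_or_pos k with rfl | hk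
  -- The time `t₁` is `x` itself, so its flow is `D` without correction.
  · refine ⟨0, fun _ _ => map_zero _, fun j => ?_⟩
    simp only [Pi.zero_apply, zero_mul, Finset.sum_const_zero, add_zero]
    rfl
  set G := PowerSeries.X ^ (2 * k + 1) * tanhTimes K with hG
  have hGd : dSeries K 0 G = 0 := by rw [hG, dSeries_X_pow_mul, dSeries_zero_tanhTimes, mul_zero]
  -- The truncated subtraction is harmless: only `i ≤ j` occurs in the sum.
  refine ⟨fun j i => algebraMap _ (RatFun K) (-PowerSeries.coeff (2 * (j - i)) G), ?_, ?_⟩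
  · intro j i
    rw [deriv_algebraMap, map_neg, ← coeff_dSeries, hGd, map_zero, neg_zero, map_zero]
  · intro j
    have h := congrArg (PowerSeries.coeff (2 * j + 1)) (dSeries_waveSeries_tanhTimes (K := K) hk)
    have hsum : PowerSeries.coeff (2 * j + 1) (G * waveSeries K (tanhTimes K)) =
        ∑ i ∈ Finset.range (j + 1), PowerSeries.coeff (2 * (j - i)) G * psiTime K i := by
      rw [PowerSeries.coeff_mul]
      symm
      refine Finset.sum_of_injOn (fun i => (2 * (j - i), 2 * i + 1)) ?_ ?_ ?_ ?_
      · intro a _ b _ hab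
        have := (Prod.mk.inj hab).2
        omega
      · intro i hi
        have := Finset.mem_range.mp (Finset.mem_coe.mp hi)
        exact Finset.mem_coe.mpr (Finset.HasAntidiagonal.mem_antidiagonal.mpr (by
          dsimp only; omega))
      · intro p hp hp'
        rw [Finset.HasAntidiagonal.mem_antidiagonal] at hp
        rcases Nat.even_or_odd p.2 with h2 | ⟨i, hi⟩
        · rw [coeff_waveSeries_of_even (fun n hn => coeff_tanhTimes_of_even K hn) h2, mul_zero]
        · exact absurd ⟨i, Finset.mem_coe.mpr (Finset.mem_range.mpr (by omega)),
            Prod.ext (by dsimp only; omega) hi.symm⟩ hp'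
      · intro i _
        rw [psiTime_eq]
    rw [map_sub, coeff_dSeries, coeff_iterate_dSeries, ← hG, hsum, ← psiTime_eq] at h
    rw [psiTimeRat, dt_algebraMap, h, map_sub, iterate_deriv_algebraMap, map_sum, sub_eq_add_neg,
      ← Finset.sum_neg_distrib]
    congr 1
    refine Finset.sum_congr rfl fun i _ => ?_
    dsimp only
    rw [map_mul, map_neg, neg_mul, psiTimeRat]

theorem satisfiesKdV_potential_tau (n : ℕ) : SatisfiesKdV (potential (tau K n)) := by
  have h0 := deriv_deriv_psiTimeRat_zero K
  have h1 := deriv_deriv_psiTimeRat_succ K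
  have h2 := psiTimeRat_zero_ne_zero K
  have hsqrt := isSqrt_dress h0 h1 h2 n
  rw [potential_tau]
  refine ⟨⟨_, hsqrt, fun Q hQ => hQ.unique hsqrt⟩, fun P hP k => ?_⟩
  obtain ⟨c, hc, hflow⟩ := dt_psiTimeRat K k
  rw [hP.unique hsqrt]
  exact lax_equation h0 h1 h2 (dt_deriv K k) (2 * k + 1) c hc hflow n

end AdlerMoser
theorem mainTheorem1 (K : Type*) [Field K] [CharZero K] :
    -- the polynomials `θ_n` are obtained from the Adler–Moser recursion, and `q_{2n-1}` is the
    -- integration constant that enters with `θ_n`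
    (AdlerMoser.theta K 0 = 1 ∧ AdlerMoser.theta K 1 = MvPolynomial.X 0 ∧
      (∀ n : ℕ, 1 ≤ n →
        MvPolynomial.pderiv 0 (AdlerMoser.theta K (n + 1)) * AdlerMoser.theta K (n - 1) -
            AdlerMoser.theta K (n + 1) * MvPolynomial.pderiv 0 (AdlerMoser.theta K (n - 1)) =
          (2 * (n : MvPolynomial ℕ K) + 1) * AdlerMoser.theta K n ^ 2) ∧
      (∀ n : ℕ, 2 ≤ n → ∃ f : MvPolynomial ℕ K, f.vars ⊆ Finset.range (n - 1) ∧
        AdlerMoser.theta K n = f + MvPolynomial.X (n - 1) * AdlerMoser.theta K (n - 2))) ∧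
    -- `q = q(t)` is the change of variables given by the hyperbolic tangent
    (AdlerMoser.qOfT K 0 = MvPolynomial.X 0 ∧
      AdlerMoser.oddSeries
          (fun k => MvPolynomial.C (AdlerMoser.alpha K k)⁻¹ * AdlerMoser.qOfT K k) =
        PowerSeries.subst
          (AdlerMoser.oddSeries (MvPolynomial.X : ℕ → MvPolynomial ℕ K)) AdlerMoser.tanhSeries ∧
      Function.Bijective
        (MvPolynomial.aeval (AdlerMoser.qOfT K) : MvPolynomial ℕ K →ₐ[K] MvPolynomial ℕ K)) ∧
    -- it transforms the `θ_n` into polynomial tau functions of the KdV hierarchy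
    (∀ n : ℕ, AdlerMoser.tau K n ≠ 0 ∧
      AdlerMoser.SatisfiesKdV (AdlerMoser.potential (AdlerMoser.tau K n))) := by
  refine ⟨⟨AdlerMoser.theta_zero K, AdlerMoser.theta_one K, fun n hn => ?_, fun n hn => ?_⟩,
    ⟨AdlerMoser.qOfT_zero K, AdlerMoser.oddSeries_qOfT K, AdlerMoser.bijective_aeval_qOfT K⟩,
    fun n => ⟨AdlerMoser.tau_ne_zero K n, AdlerMoser.satisfiesKdV_potential_tau K n⟩⟩
  · obtain ⟨m, rfl⟩ := Nat.exists_eq_add_of_le' hn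
    exact AdlerMoser.theta_recursion K m
  · obtain ⟨m, rfl⟩ := Nat.exists_eq_add_of_le' hn
    exact AdlerMoser.theta_integration_constant K m
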